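/- \textbf{Proposition (Minimal length graphs orbit the convex core).} For all $n$, $\epsilon>0$ and $k$ there is a constant $D=D(n,\epsilon,k)>0$ such that the following holds. Let $M=\mathbb H^n/\Gamma$ be a hyperbolic $n$-manifold, where $\Gamma$ is a discrete torsion-free group of isometries of $\mathbb H^n$, and let $f:X\to M$ be a reduced carrier graph with minimal length rel vertices, such that $\pi_1(X)$ has rank at least $2$ and the Stallings core $core(X)$ has $k$ edges. Then $$f(core(X))\subset \mathcal N_D(core_\epsilon(M)),$$ where $\mathcal N_D$ denotes the radius-$D$ neighborhood in $M$. Here a \emph{carrier graph} is a continuous map $f:X\to M$ from a connected finite graph $X$ (loops and multiple edges are allowed) that is surjective on $\pi_1$. It is \emph{reduced} if no simple closed curve on $X$ is mapped to a point. The \emph{Stallings core} $core(X)$ is the smallest subgraph of $X$ whose inclusion is a homotopy equivalence; it is obtained by removing every edge whose interior divides $X$ into two components one of which is a tree. An \emph{edge move} on $f$ creates a map $g:Y\to M$ as follows. Pick an edge $e$ of $X$ with vertices $v_0,v_1$ and a path $\alpha$ from $v_1$ to a point $w$ in the complement $X\setminus e$ of the interior of $e$. Sever $e$ from $v_1$ and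 reattach its free end to $w$; if $w$ is not a vertex of $X$, make it a new vertex. Map the reattached edge to a path in the class $f(e)\cdot f(\alpha)$, let $g=f$ elsewhere, and then homotope $g$ while fixing all the vertices of $X$ (so only $w$ may move, if it is new). The map $f$ has \emph{minimal length rel vertices} if no edge move decreases the total edge length. Finally, let $Thin_\epsilon(\Gamma)$ be the set of $x\in\mathbb H^n$ with $d(x,\gamma x)<\epsilon$ for some nontrivial $\gamma\in\Gamma$, and let $hull_\epsilon(\Gamma)$ be the smallest nonempty closed convex $\Gamma$-invariant subset of $\mathbb H^n$ that contains $Thin_\epsilon(\Gamma)$. The \emph{$\epsilon$-thickened convex core} $core_\epsilon(M)$ is the projection of $hull_\epsilon(\Gamma)$ to $M$. -/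

import Mathlib

open Set
open scoped ENNReal unitInterval

/-! ### Hyperbolic space -/

/-- Hyperbolic `n`-space in the hyperboloid model: the upper sheet `x₀ > 0` of the quadric
`x₀ ^ 2 = 1 + ‖x‖ ^ 2` in `ℝ × ℝⁿ`. -/
@[ext]
structure HypSpace (n : ℕ) where
  /-- the time coordinate `x₀` -/
  time : ℝ
  /-- the space coordinates -/
  space : EuclideanSpace ℝ (Fin n)
  time_pos : 0 < time
  time_sq : time ^ 2 = 1 + ‖space‖ ^ 2

namespace HypSpace

variable {n : ℕ}

/-- Minus the Lorentz product, `x₀ y₀ - ⟪x, y⟫`; it equals `cosh d(x, y)`. -/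
noncomputable def form (x y : HypSpace n) : ℝ :=
  x.time * y.time - inner ℝ x.space y.space

theorem form_self (x : HypSpace n) : form x x = 1 := by
  have := x.time_sq
  simp only [form, real_inner_self_eq_norm_sq]
  linarith

theorem form_comm (x y : HypSpace n) : form x y = form y x := by
  simp only [form, real_inner_comm, mul_comm]

/-- The Lorentz product is positive semidefinite on the orthogonal complement of a point. -/
theorem lorentz_nonneg (y : HypSpace n) (t : ℝ) (u : EuclideanSpace ℝ (Fin n))
    (h : t * y.time = inner ℝ u y.space) : t ^ 2 ≤ ‖u‖ ^ 2 := by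
  have h1 : (t * y.time) ^ 2 ≤ (‖u‖ * ‖y.space‖) ^ 2 := by
    rw [h]
    exact sq_le_sq' (by have := abs_real_inner_le_norm u y.space
                        linarith [neg_abs_le (inner ℝ u y.space)]) (real_inner_le_norm u y.space)
  have h2 := y.time_sq
  have h3 : t ^ 2 * (1 + ‖y.space‖ ^ 2) ≤ ‖u‖ ^ 2 * ‖y.space‖ ^ 2 := by
    rw [← h2]; nlinarith
  by_contra hlt
  push Not at hlt
  nlinarith [sq_nonneg ‖y.space‖, sq_nonneg ‖u‖]

/-- Cauchy-Schwarz on the Lorentz-orthogonal complement of `y`, applied to the components of `x`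
and `z`. -/
theorem form_gram (x y z : HypSpace n) :
    (form x z - form x y * form y z) ^ 2 ≤ (form x y ^ 2 - 1) * (form y z ^ 2 - 1) := by
  have hx := x.time_sq
  have hy := y.time_sq
  have hz := z.time_sq
  have key : ∀ a b : ℝ, 0 ≤ a * a * (form x y ^ 2 - 1) +
      2 * (a * b) * (form x y * form y z - form x z) + b * b * (form y z ^ 2 - 1) := by
    intro a b
    have h := lorentz_nonneg y
      (a * (x.time - form x y * y.time) + b * (z.time - form y z * y.time))
      (a • (x.space - form x y • y.space) + b • (z.space - form y z • y.space)) (by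
        simp only [inner_add_left, inner_sub_left, real_inner_smul_left,
          real_inner_self_eq_norm_sq]
        have e1 : inner ℝ x.space y.space = x.time * y.time - form x y := by simp [form]
        have e2 : inner ℝ z.space y.space = z.time * y.time - form y z := by
          rw [form_comm]; simp [form]
        rw [e1, e2]
        linear_combination (-(a * form x y + b * form y z)) * hy)
    rw [← real_inner_self_eq_norm_sq] at h
    simp only [inner_add_left, inner_sub_left, real_inner_smul_left, inner_add_right,
      inner_sub_right, real_inner_smul_right] at h
    have e1 : inner ℝ x.space y.space = x.time * y.time - form x y := by simp [form]
    have e1' : inner ℝ y.space x.space = x.time * y.time - form x y := by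
      rw [real_inner_comm]; exact e1
    have e2 : inner ℝ z.space y.space = z.time * y.time - form y z := by
      rw [form_comm]; simp [form]
    have e2' : inner ℝ y.space z.space = z.time * y.time - form y z := by
      rw [real_inner_comm]; exact e2
    have e3 : inner ℝ x.space z.space = x.time * z.time - form x z := by simp [form]
    have e3' : inner ℝ z.space x.space = x.time * z.time - form x z := by
      rw [real_inner_comm]; exact e3
    rw [e1, e1', e2, e2', e3, e3', real_inner_self_eq_norm_sq, real_inner_self_eq_norm_sq,
      real_inner_self_eq_norm_sq] at h
    have nx : ‖x.space‖ ^ 2 = x.time ^ 2 - 1 := by linarith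
    have ny : ‖y.space‖ ^ 2 = y.time ^ 2 - 1 := by linarith
    have nz : ‖z.space‖ ^ 2 = z.time ^ 2 - 1 := by linarith
    rw [nx, ny, nz] at h
    linarith [h]
  have hP : 0 ≤ form x y ^ 2 - 1 := by have := key 1 0; linarith
  have hQ : 0 ≤ form y z ^ 2 - 1 := by have := key 0 1; linarith
  have h := discrim_le_zero (a := form x y ^ 2 - 1)
    (b := 2 * (form x y * form y z - form x z)) (c := form y z ^ 2 - 1)
    (fun t => by have := key t 1; nlinarith)
  unfold discrim at h
  nlinarith

theorem one_le_form (x y : HypSpace n) : 1 ≤ form x y := by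
  have hx := x.time_sq
  have hy := y.time_sq
  have h1 := real_inner_le_norm x.space y.space
  have h2 : (1 + ‖x.space‖ * ‖y.space‖) ^ 2 ≤ (x.time * y.time) ^ 2 := by
    rw [mul_pow, hx, hy]
    nlinarith [sq_nonneg (‖x.space‖ - ‖y.space‖)]
  have h3 := abs_le_of_sq_le_sq' h2 (mul_pos x.time_pos y.time_pos).le
  unfold form
  linarith [h3.2]

/-- The hyperbolic metric: `cosh d(x, y) = x₀ y₀ - ⟪x, y⟫`. -/
noncomputable instance : MetricSpace (HypSpace n) where
  dist x y := Real.arcosh (form x y)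
  dist_self x := by simp [form_self]
  dist_comm x y := by rw [form_comm]
  dist_triangle x y z := by
    have hxy := one_le_form x y
    have hyz := one_le_form y z
    have hxz := one_le_form x z
    have h0 : 0 ≤ Real.arcosh (form x y) + Real.arcosh (form y z) :=
      add_nonneg (Real.arcosh_nonneg hxy) (Real.arcosh_nonneg hyz)
    rw [← Real.arcosh_cosh h0, Real.arcosh_le_arcosh (by linarith) (Real.cosh_pos _),
      Real.cosh_add, Real.cosh_arcosh hxy, Real.cosh_arcosh hyz, Real.sinh_arcosh hxy,
      Real.sinh_arcosh hyz, ← Real.sqrt_mul (by nlinarith)]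
    have := Real.le_sqrt_of_sq_le (form_gram x y z)
    linarith
  eq_of_dist_eq_zero {x y} h := by
    have h1 : form x y = 1 := (Real.arcosh_eq_zero_iff (one_le_form x y)).1 h
    have hx := x.time_sq
    have hy := y.time_sq
    have h2 : ‖x.space - y.space‖ ^ 2 = (x.time - y.time) ^ 2 := by
      have e : inner ℝ x.space y.space = x.time * y.time - 1 := by rw [← h1]; simp [form]
      rw [norm_sub_sq_real, e]; linarith
    have h3 : (y.time • x.space - x.time • y.space) = 0 := by
      have e : inner ℝ x.space y.space = x.time * y.time - 1 := by rw [← h1]; simp [form]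
      have e2 : ‖y.time • x.space - x.time • y.space‖ ^ 2 = - (x.time - y.time) ^ 2 := by
        rw [norm_sub_sq_real, norm_smul, norm_smul, real_inner_smul_left,
          real_inner_smul_right, e, mul_pow, mul_pow, Real.norm_eq_abs, Real.norm_eq_abs,
          sq_abs, sq_abs]
        have nx : ‖x.space‖ ^ 2 = x.time ^ 2 - 1 := by linarith
        have ny : ‖y.space‖ ^ 2 = y.time ^ 2 - 1 := by linarith
        rw [nx, ny]; ring
      have : ‖y.time • x.space - x.time • y.space‖ ^ 2 = 0 :=
        le_antisymm (by rw [e2]; nlinarith [sq_nonneg (x.time - y.time)]) (sq_nonneg _)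
      exact norm_eq_zero.1 (pow_eq_zero_iff two_ne_zero |>.1 this)
    have ht : x.time = y.time := by
      have e : inner ℝ x.space y.space = x.time * y.time - 1 := by rw [← h1]; simp [form]
      have e3 : inner ℝ x.space (y.time • x.space - x.time • y.space) = 0 := by
        rw [h3, inner_zero_right]
      rw [inner_sub_right, real_inner_smul_right, real_inner_smul_right,
        real_inner_self_eq_norm_sq, e] at e3
      have nx : ‖x.space‖ ^ 2 = x.time ^ 2 - 1 := by linarith
      rw [nx] at e3
      linarith
    have hs : x.space = y.space := by
      rw [ht, sub_self] at h2
      have : ‖x.space - y.space‖ = 0 := by simpa using h2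
      exact sub_eq_zero.1 (norm_eq_zero.1 this)
    exact HypSpace.ext ht hs

theorem dist_def (x y : HypSpace n) : dist x y = Real.arcosh (form x y) := rfl

end HypSpace

/-! ### Hyperbolic manifolds and their thickened convex cores -/

/-- `Γ` acts freely and properly discontinuously on `ℍⁿ`, that is, `Γ` is a discrete
torsion-free group of isometries; the quotients `ℍⁿ / Γ` by such groups are the (complete,
connected) hyperbolic `n`-manifolds. -/
structure IsHyperbolicManifoldGroup {n : ℕ} (Γ : Subgroup (HypSpace n ≃ᵢ HypSpace n)) :
    Prop where
  free : ∀ γ ∈ Γ, ∀ x, γ x = x → γ = 1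
  discrete : ∀ (x : HypSpace n) (r : ℝ),
    {γ : HypSpace n ≃ᵢ HypSpace n | γ ∈ Γ ∧ dist x (γ x) ≤ r}.Finite

/-- The orbit relation of `Γ`. -/
def hypOrbitSetoid {n : ℕ} (Γ : Subgroup (HypSpace n ≃ᵢ HypSpace n)) : Setoid (HypSpace n) where
  r x y := ∃ γ ∈ Γ, γ x = y
  iseqv :=
    { refl := fun x => ⟨1, Γ.one_mem, rfl⟩
      symm := by
        rintro x y ⟨γ, hγ, rfl⟩
        exact ⟨γ⁻¹, Γ.inv_mem hγ, γ.symm_apply_apply x⟩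
      trans := by
        rintro x y z ⟨γ, hγ, rfl⟩ ⟨η, hη, rfl⟩
        exact ⟨η * γ, Γ.mul_mem hη hγ, rfl⟩ }

/-- The quotient `M = ℍⁿ / Γ`. -/
def HypQuotient {n : ℕ} (Γ : Subgroup (HypSpace n ≃ᵢ HypSpace n)) : Type :=
  Quotient (hypOrbitSetoid Γ)

namespace HypQuotient

variable {n : ℕ} (Γ : Subgroup (HypSpace n ≃ᵢ HypSpace n))

/-- The covering projection `ℍⁿ → M`. -/
def proj (x : HypSpace n) : HypQuotient Γ := Quotient.mk (hypOrbitSetoid Γ) x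

theorem proj_surjective : Function.Surjective (proj Γ) := Quotient.mk_surjective

theorem proj_eq_iff {x y : HypSpace n} : proj Γ x = proj Γ y ↔ ∃ γ ∈ Γ, γ x = y :=
  Quotient.eq (r := hypOrbitSetoid Γ)

/-- The distances between lifts of `p` and lifts of `q`. -/
def distSet (p q : HypQuotient Γ) : Set ℝ :=
  {r | ∃ x y, proj Γ x = p ∧ proj Γ y = q ∧ dist x y = r}

theorem distSet_nonempty (p q : HypQuotient Γ) : (distSet Γ p q).Nonempty := by
  obtain ⟨x, rfl⟩ := proj_surjective Γ p
  obtain ⟨y, rfl⟩ := proj_surjective Γ q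
  exact ⟨_, x, y, rfl, rfl, rfl⟩

theorem distSet_nonneg (p q : HypQuotient Γ) : ∀ r ∈ distSet Γ p q, 0 ≤ r := by
  rintro r ⟨x, y, -, -, rfl⟩
  exact dist_nonneg

/-- The quotient metric of `M`: the distance of two points is the infimum of the distances
between their lifts. Its topology is used on `M`. -/
noncomputable instance : PseudoMetricSpace (HypQuotient Γ) where
  dist p q := sInf (distSet Γ p q)
  dist_self p := by
    obtain ⟨x, rfl⟩ := proj_surjective Γ p
    exact le_antisymm (csInf_le ⟨0, distSet_nonneg Γ _ _⟩ ⟨x, x, rfl, rfl, dist_self x⟩)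
      (Real.sInf_nonneg (distSet_nonneg Γ _ _))
  dist_comm p q := by
    congr 1
    ext r
    constructor <;> rintro ⟨x, y, hx, hy, rfl⟩ <;> exact ⟨y, x, hy, hx, dist_comm _ _⟩
  dist_triangle p q r := by
    refine le_of_forall_pos_le_add fun e he => ?_
    obtain ⟨_, ⟨x, y, hx, hy, rfl⟩, h1⟩ :=
      Real.lt_sInf_add_pos (distSet_nonempty Γ p q) (half_pos he)
    obtain ⟨_, ⟨y', z, hy', hz, rfl⟩, h2⟩ :=
      Real.lt_sInf_add_pos (distSet_nonempty Γ q r) (half_pos he)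
    obtain ⟨γ, hγ, hγy⟩ := (proj_eq_iff Γ).1 (hy'.trans hy.symm)
    have h3 : sInf (distSet Γ p r) ≤ dist x (γ z) :=
      csInf_le ⟨0, distSet_nonneg Γ _ _⟩
        ⟨x, γ z, hx, ((proj_eq_iff Γ).2 ⟨γ, hγ, rfl⟩).symm.trans hz, rfl⟩
    have h4 : dist y (γ z) = dist y' z := by rw [← hγy, γ.isometry.dist_eq]
    have h5 := dist_triangle x y (γ z)
    linarith

end HypQuotient

section ConvexCore

variable {n : ℕ}

/-- `A ⊆ ℍⁿ` is convex: it contains the geodesic segment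
`[x, y] = {z | d(x, z) + d(z, y) = d(x, y)}` for all its points `x`, `y`. -/
def HypConvex (A : Set (HypSpace n)) : Prop :=
  ∀ x ∈ A, ∀ y ∈ A, ∀ z, dist x z + dist z y = dist x y → z ∈ A

/-- The set of points of `ℍⁿ` moved by less than `ε` by some nontrivial element of `Γ`. -/
def thinSet (Γ : Subgroup (HypSpace n ≃ᵢ HypSpace n)) (ε : ℝ) : Set (HypSpace n) :=
  {x | ∃ γ ∈ Γ, γ ≠ 1 ∧ dist x (γ x) < ε}

/-- The `ε`-thickened convex hull of `Γ`: the smallest nonempty closed convex `Γ`-invariant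
subset of `ℍⁿ` that contains the `ε`-thin set. -/
def thickHull (Γ : Subgroup (HypSpace n ≃ᵢ HypSpace n)) (ε : ℝ) : Set (HypSpace n) :=
  ⋂₀ {C | C.Nonempty ∧ IsClosed C ∧ HypConvex C ∧ (∀ γ ∈ Γ, ∀ x ∈ C, γ x ∈ C) ∧
    thinSet Γ ε ⊆ C}

/-- The `ε`-thickened convex core of `M = ℍⁿ / Γ`: the projection of the `ε`-thickened convex
hull of `Γ`. -/
def thickCore (Γ : Subgroup (HypSpace n ≃ᵢ HypSpace n)) (ε : ℝ) : Set (HypQuotient Γ) :=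
  HypQuotient.proj Γ '' thickHull Γ ε

end ConvexCore

/-! ### Graphs -/

/-- A graph with vertex set `V` and edge set `E`; loops and multiple edges are allowed. Every
edge carries an (arbitrary) orientation. -/
structure MultiGraph (V E : Type*) where
  /-- the initial vertex of an edge -/
  src : E → V
  /-- the terminal vertex of an edge -/
  tgt : E → V

namespace MultiGraph

variable {V E : Type*} (G : MultiGraph V E)

/-- The initial vertex of an oriented edge; `(e, true)` is `e` with its own orientation and
`(e, false)` is `e` with the opposite one. -/
def dsrc : E × Bool → V
  | (e, true) => G.src e
  | (e, false) => G.tgt e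

/-- The terminal vertex of an oriented edge. -/
def dtgt : E × Bool → V
  | (e, true) => G.tgt e
  | (e, false) => G.src e

/-- Edge paths from `u` to `v`. -/
inductive EdgePath : V → V → Type _
  | nil (u : V) : EdgePath u u
  | cons {u v w : V} (d : E × Bool) (hs : G.dsrc d = u) (ht : G.dtgt d = v)
      (p : EdgePath v w) : EdgePath u w

variable {G}

/-- The edges that an edge path runs through. -/
def EdgePath.edges : {u v : V} → G.EdgePath u v → List E
  | _, _, .nil _ => []
  | _, _, .cons d _ _ p => d.1 :: p.edges

/-- The vertices that an edge path visits, without its last one. -/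
def EdgePath.starts : {u v : V} → G.EdgePath u v → List V
  | _, _, .nil _ => []
  | u, _, .cons _ _ _ p => u :: p.starts

/-- The edge path is a simple closed curve. -/
def EdgePath.IsSimpleClosed {v : V} (p : G.EdgePath v v) : Prop :=
  p.edges ≠ [] ∧ p.edges.Nodup ∧ p.starts.Nodup

variable (G)

/-- The graph is connected (and nonempty). -/
def Connected : Prop := Nonempty V ∧ ∀ u v, Nonempty (G.EdgePath u v)

/-- `u` and `v` lie in the same component of the graph with the open edge `e` removed. -/
def JoinedAvoiding (e : E) (u v : V) : Prop := ∃ p : G.EdgePath u v, e ∉ p.edges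

/-- The component of the vertex `u` in the graph with the open edge `e` removed is a tree. -/
def TreeComponentAvoiding (e : E) (u : V) : Prop :=
  ∀ v, G.JoinedAvoiding e u v → ∀ p : G.EdgePath v v, e ∉ p.edges → ¬ p.IsSimpleClosed

/-- The edges of the Stallings core of a connected graph: one removes every edge whose interior
divides the graph into two components one of which is a tree. (When the graph is not a tree, the
core consists of the remaining edges and their endpoints.) -/
def coreEdges : Set E :=
  {e | ¬ (¬ G.JoinedAvoiding e (G.src e) (G.tgt e) ∧
    (G.TreeComponentAvoiding e (G.src e) ∨ G.TreeComponentAvoiding e (G.tgt e)))}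

open Classical in
/-- Sever the edge of `d` from its terminal vertex and reattach its free end to the vertex `w`.
(The edge is oriented towards `w`.) -/
noncomputable def reattach (d : E × Bool) (w : V) : MultiGraph V E where
  src e := if e = d.1 then G.dsrc d else G.src e
  tgt e := if e = d.1 then w else G.tgt e

open Classical in
/-- Subdivide the edge `h` by a new vertex `none`, its two halves being `some h` (from the initial
vertex of `h` to the new vertex) and `none` (from the new vertex to the terminal vertex of `h`),
sever the edge of `d` from its terminal vertex and reattach its free end to the new vertex.
Used for `h ≠ d.1`. -/
noncomputable def reattachMid (d : E × Bool) (h : E) : MultiGraph (Option V) (Option E) where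
  src e := match e with
    | none => none
    | some e => if e = d.1 then some (G.dsrc d) else some (G.src e)
  tgt e := match e with
    | none => some (G.tgt h)
    | some e => if e = d.1 ∨ e = h then none else some (G.tgt e)

end MultiGraph

/-! ### Carrier graphs -/

/-- Two paths have the same endpoints and are homotopic relative to them. -/
def PathHomotopic {M : Type*} [TopologicalSpace M] {a b c d : M} (p : Path a b) (q : Path c d) :
    Prop :=
  ∃ (h₁ : a = c) (h₂ : b = d), p.Homotopic (q.cast h₁ h₂)

/-- A continuous map from (the geometric realization of) the graph `G` to the space `M`, given by
its values at the vertices and its restrictions to the edges. -/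
structure GraphMap {V E : Type*} (G : MultiGraph V E) (M : Type*) [TopologicalSpace M] where
  /-- the value at a vertex -/
  vert : V → M
  /-- the restriction to an edge -/
  edge : ∀ e, Path (vert (G.src e)) (vert (G.tgt e))

namespace GraphMap

variable {V E : Type*} {G : MultiGraph V E} {M : Type*}

section Topological

variable [TopologicalSpace M] (f : GraphMap G M)

/-- The restriction to an oriented edge. -/
def dart : ∀ d : E × Bool, Path (f.vert (G.dsrc d)) (f.vert (G.dtgt d))
  | (e, true) => f.edge e
  | (e, false) => (f.edge e).symm

/-- The image of an edge path. -/
noncomputable def pathMap (f : GraphMap G M) :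
    {u v : V} → G.EdgePath u v → Path (f.vert u) (f.vert v)
  | _, _, .nil u => Path.refl (f.vert u)
  | _, _, .cons d hs ht p =>
    ((f.dart d).cast (congrArg f.vert hs.symm) (congrArg f.vert ht.symm)).trans (pathMap f p)

/-- A carrier graph: a map from a connected graph that is surjective on fundamental groups. -/
structure IsCarrierGraph : Prop where
  connected : G.Connected
  surjective : ∀ (v : V) (c : Path (f.vert v) (f.vert v)),
    ∃ p : G.EdgePath v v, (f.pathMap p).Homotopic c

/-- No simple closed curve of the graph is mapped to a point. -/
def IsReduced : Prop :=
  ∀ (v : V) (p : G.EdgePath v v), p.IsSimpleClosed →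
    ¬ ∃ x : M, ∀ e ∈ p.edges, ∀ t : I, f.edge e t = x

/-- The image of the Stallings core (for a graph that is not a tree). -/
def coreImage : Set M := ⋃ e ∈ G.coreEdges, range (f.edge e)

/-- `g` arises from `f` by an edge move that drags the terminal end of the oriented edge `d` along
the edge path `α`, which avoids this edge, to the vertex `w`, followed by a homotopy relative to
the vertices. -/
structure IsVertexMove (d : E × Bool) {w : V} (α : G.EdgePath (G.dtgt d) w)
    (g : GraphMap (G.reattach d w) M) : Prop where
  avoids : d.1 ∉ α.edges
  vert_eq : ∀ v, g.vert v = f.vert v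
  moved : PathHomotopic (g.edge d.1) ((f.dart d).trans (f.pathMap α))
  other : ∀ e, e ≠ d.1 → PathHomotopic (g.edge e) (f.edge e)

/-- The image of the initial segment of the edge `h`, up to the parameter `t`. -/
noncomputable def headSegment (h : E) (t : I) : Path (f.vert (G.src h)) (f.edge h t) :=
  ((f.edge h).subpath 0 t).cast (f.edge h).source.symm rfl

/-- The image of the final segment of the edge `h`, from the parameter `t` on. -/
noncomputable def tailSegment (h : E) (t : I) : Path (f.edge h t) (f.vert (G.tgt h)) :=
  ((f.edge h).subpath t 1).cast rfl (f.edge h).target.symm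

/-- `g` arises from `f` by an edge move that drags the terminal end of the oriented edge `d` to the
interior point `w` with parameter `t` of another edge `h`, followed by a homotopy that fixes all
the vertices except the new vertex `w`. The end is dragged along the edge path `α` to the initial
vertex of `h` and then along `h` to `w`; up to homotopy, every path to `w` that avoids the edge of
`d` is of this form, as `α` may end by running backwards through all of `h`. The path `δ` is the
trace of `w` under the homotopy. -/
structure IsInteriorMove (d : E × Bool) (h : E) (α : G.EdgePath (G.dtgt d) (G.src h)) (t : I)
    (g : GraphMap (G.reattachMid d h) M) : Prop where
  ne : h ≠ d.1
  interior : 0 < t ∧ t < 1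
  avoids : d.1 ∉ α.edges
  vert_eq : ∀ v, g.vert (some v) = f.vert v
  moved : ∃ δ : Path (f.edge h t) (g.vert none),
    PathHomotopic (g.edge (some h)) ((f.headSegment h t).trans δ) ∧
    PathHomotopic (g.edge none) (δ.symm.trans (f.tailSegment h t)) ∧
    PathHomotopic (g.edge (some d.1))
      (((f.dart d).trans (f.pathMap α)).trans ((f.headSegment h t).trans δ))
  other : ∀ e, e ≠ d.1 → e ≠ h → PathHomotopic (g.edge (some e)) (f.edge e)

end Topological

section Metric

variable [PseudoMetricSpace M]

/-- The total edge length. -/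
noncomputable def length [Fintype E] (f : GraphMap G M) : ℝ≥0∞ :=
  ∑ e, eVariationOn (f.edge e) Set.univ

/-- `f` has minimal length rel vertices: it does not admit a length-decreasing edge move. -/
structure MinimalRelVertices [Fintype E] (f : GraphMap G M) : Prop where
  vertex : ∀ (d : E × Bool) (w : V) (α : G.EdgePath (G.dtgt d) w)
    (g : GraphMap (G.reattach d w) M), f.IsVertexMove d α g → f.length ≤ g.length
  interior : ∀ (d : E × Bool) (h : E) (α : G.EdgePath (G.dtgt d) (G.src h)) (t : I)
    (g : GraphMap (G.reattachMid d h) M), f.IsInteriorMove d h α t g → f.length ≤ g.length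

end Metric

end GraphMap

/-! ### Coarse geometry of hyperbolic space -/

namespace HypSpace

variable {n : ℕ}

/-! Lift everything to ℍⁿ, let C be the thickened hull, and call the distance to C height.
Minimality makes every edge geodesic (`eVariationOn_edge_le`), and neighbourhoods of convex sets are
coarsely convex (`dist_foot_between`), so it suffices to bound the height of the vertices of the
core (`height_lt`).

Suppose that a highest core vertex v has a huge height R₁. Since the core has only k edges, there is
a gap between their lengths: each is either short, below some ℓ, or long, at least 5kℓ + ℓ + 17
(`exists_lengthScale_gap`). Let S be the set of vertices joined to v by short edges. Along simple
paths of short edges, lifts of points of S are within c = kℓ of each other, so all of S has height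
at least R₁ - c.

No simple closed curve of short edges lies at S. Its holonomy would move a high point by at most c.
But the thin set lies in C, so a nontrivial element moves the foot of an exterior point by at least
ε, and perpendiculars to a convex set diverge exponentially (`cosh_mul_sinh_le`). Nor can the
holonomy be trivial: each edge of the curve could be dragged around the rest and contracted, so by
minimality the curve would already be a point, which a reduced map forbids (`hol_ne_one`).

As the rank is at least two, two different long core edges therefore leave S (`exists_two_darts`).
They start within c of each other, almost at the maximal height, and end no higher than R₁, so both
set out downwards along nearly the same perpendicular. By hyperbolicity (`four_point`, from
Ptolemy's inequality) they run together for longer than c. Dragging the end of one through S and a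
little way along the other shortens it (`exists_shortcut`), against minimality (`len_le_of_dart`).

This also needs the hull to be nonempty when nothing is thin (`thickHull_nonempty`). The resulting D
depends on ε and k only. -/

theorem cosh_dist (x y : HypSpace n) : Real.cosh (dist x y) = form x y := by
  rw [dist_def, Real.cosh_arcosh (one_le_form x y)]

theorem form_sub_one (x y : HypSpace n) :
    form x y - 1 = 2 * Real.sinh (dist x y / 2) ^ 2 := by
  rw [← cosh_dist]
  have h := Real.cosh_two_mul (dist x y / 2)
  have h' := Real.cosh_sq (dist x y / 2)
  rw [mul_div_cancel₀ _ (two_ne_zero)] at h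
  linarith

theorem sinh_half_nonneg (x y : HypSpace n) : 0 ≤ Real.sinh (dist x y / 2) :=
  Real.sinh_nonneg_iff.2 (by positivity)

/-- The projection to the Poincaré ball. -/
noncomputable def toBall (x : HypSpace n) : EuclideanSpace ℝ (Fin n) := (1 + x.time)⁻¹ • x.space

/-- Up to one factor per point, 2 sinh(d/2) is the Euclidean distance in the ball. Every term of
Ptolemy's inequality contains each of the four points once, so these factors cancel there and the
Euclidean inequality passes to ℍⁿ. -/
theorem dist_toBall_sq (x y : HypSpace n) :
    dist (toBall x) (toBall y) ^ 2 * ((1 + x.time) * (1 + y.time)) =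
      (2 * Real.sinh (dist x y / 2)) ^ 2 := by
  have hx := x.time_sq
  have hy := y.time_sq
  have px := x.time_pos
  have py := y.time_pos
  have h : (2 * Real.sinh (dist x y / 2)) ^ 2 = 2 * (form x y - 1) := by
    rw [form_sub_one]; ring
  rw [h, dist_eq_norm, toBall, toBall, norm_sub_sq_real, norm_smul, norm_smul, real_inner_smul_left,
    real_inner_smul_right, mul_pow, mul_pow, Real.norm_eq_abs, Real.norm_eq_abs, sq_abs, sq_abs,
    form]
  have nx : ‖x.space‖ ^ 2 = x.time ^ 2 - 1 := by linarith
  have ny : ‖y.space‖ ^ 2 = y.time ^ 2 - 1 := by linarith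
  rw [nx, ny]
  field_simp
  ring

theorem dist_toBall_mul (x y : HypSpace n) :
    dist (toBall x) (toBall y) * (Real.sqrt (1 + x.time) * Real.sqrt (1 + y.time)) =
      2 * Real.sinh (dist x y / 2) := by
  have px := x.time_pos
  have py := y.time_pos
  refine (pow_left_inj₀ (by positivity) (by have := sinh_half_nonneg x y; positivity)
    two_ne_zero).1 ?_
  rw [← dist_toBall_sq, mul_pow, mul_pow, Real.sq_sqrt (by positivity), Real.sq_sqrt (by positivity)]

/-- Ptolemy's inequality in hyperbolic space. -/
theorem ptolemy (a b c d : HypSpace n) :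
    Real.sinh (dist a c / 2) * Real.sinh (dist b d / 2) ≤
      Real.sinh (dist a b / 2) * Real.sinh (dist c d / 2) +
        Real.sinh (dist b c / 2) * Real.sinh (dist a d / 2) := by
  have h := EuclideanGeometry.mul_dist_le_mul_dist_add_mul_dist (toBall a) (toBall b) (toBall c) (toBall d)
  have pa := a.time_pos
  have pb := b.time_pos
  have pc := c.time_pos
  have pd := d.time_pos
  have h2 := mul_le_mul_of_nonneg_right h (show (0 : ℝ) ≤ Real.sqrt (1 + a.time) *
    Real.sqrt (1 + b.time) * Real.sqrt (1 + c.time) * Real.sqrt (1 + d.time) by positivity)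
  have hac := dist_toBall_mul a c
  have hbd := dist_toBall_mul b d
  have hab := dist_toBall_mul a b
  have hcd := dist_toBall_mul c d
  have hbc := dist_toBall_mul b c
  have had := dist_toBall_mul a d
  have e1 : (2 * Real.sinh (dist a c / 2)) * (2 * Real.sinh (dist b d / 2)) ≤
      (2 * Real.sinh (dist a b / 2)) * (2 * Real.sinh (dist c d / 2)) +
        (2 * Real.sinh (dist b c / 2)) * (2 * Real.sinh (dist a d / 2)) := by
    rw [← hac, ← hbd, ← hab, ← hcd, ← hbc, ← had]
    linarith
  linarith

theorem log_four_le : Real.log 4 ≤ 3 / 2 := by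
  have h : (4 : ℝ) = 2 ^ 2 := by norm_num
  rw [h, Real.log_pow]
  have := Real.log_two_lt_d9
  push_cast
  linarith

/-- The four-point inequality of Gromov: hyperbolic space is a hyperbolic metric space. -/
theorem four_point (x y z w : HypSpace n) :
    dist x y + dist z w ≤ max (dist x z + dist y w) (dist x w + dist y z) + 3 := by
  set m := max (dist x z + dist y w) (dist x w + dist y z) with hm
  have m1 : dist x z + dist y w ≤ m := le_max_left _ _
  have m2 : dist x w + dist y z ≤ m := le_max_right _ _
  have hp := ptolemy x z y w
  have up : ∀ t : ℝ, Real.sinh (t / 2) ≤ Real.exp (t / 2) / 2 := fun t => by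
    rw [Real.sinh_eq]; have := Real.exp_pos (-(t / 2)); linarith
  have lo : ∀ t : ℝ, 0 ≤ t → (Real.exp (t / 2) - 1) / 2 ≤ Real.sinh (t / 2) := fun t ht => by
    rw [Real.sinh_eq]
    have : Real.exp (-(t / 2)) ≤ 1 := Real.exp_le_one_iff.2 (by linarith)
    linarith
  have one : ∀ t : ℝ, 0 ≤ t → 1 ≤ Real.exp (t / 2) := fun t ht =>
    Real.one_le_exp (by positivity)
  set M := Real.exp (m / 2) with hM
  have b1 : Real.exp (dist x z / 2) * Real.exp (dist y w / 2) ≤ M := by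
    rw [← Real.exp_add]; exact Real.exp_le_exp.2 (by linarith)
  have b2 : Real.exp (dist z y / 2) * Real.exp (dist x w / 2) ≤ M := by
    rw [← Real.exp_add, dist_comm z y]; exact Real.exp_le_exp.2 (by linarith)
  have t1 := dist_triangle x z y
  have t2 := dist_triangle x w y
  have t3 := dist_triangle z x w
  have t4 := dist_triangle z y w
  rw [dist_comm z y] at t1 t4
  rw [dist_comm w y] at t2
  rw [dist_comm z x] at t3
  have b3 : Real.exp (dist x y / 2) ≤ M := Real.exp_le_exp.2 (by linarith)
  have b4 : Real.exp (dist z w / 2) ≤ M := Real.exp_le_exp.2 (by linarith)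
  have l1 := mul_le_mul (lo (dist x y) dist_nonneg) (lo (dist z w) dist_nonneg)
    (by have := one (dist z w) dist_nonneg; linarith) (sinh_half_nonneg x y)
  have u1 := mul_le_mul (up (dist x z)) (up (dist y w)) (sinh_half_nonneg y w) (by positivity)
  have u2 := mul_le_mul (up (dist z y)) (up (dist x w)) (sinh_half_nonneg x w) (by positivity)
  -- Expanding the lower bound for the left side of Ptolemy leaves 2M plus the two single
  -- exponentials, each at most M because adding triangle inequalities bounds either distance by m.
  -- The factor 4 costs 2 log 4 ≤ 3.
  have key : Real.exp ((dist x y + dist z w) / 2) ≤ 4 * M := by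
    have : Real.exp ((dist x y + dist z w) / 2) =
        Real.exp (dist x y / 2) * Real.exp (dist z w / 2) := by
      rw [← Real.exp_add]; ring_nf
    rw [this]
    nlinarith
  have : Real.exp ((dist x y + dist z w) / 2) ≤ Real.exp (Real.log 4 + m / 2) := by
    rw [Real.exp_add, Real.exp_log (by norm_num)]; exact key
  have := Real.exp_le_exp.1 this
  have := log_four_le
  linarith

/-! ### Geodesics -/

/-- A positive combination of two points of the hyperboloid that lies on the hyperboloid. -/
noncomputable def comb (x y : HypSpace n) (a b : ℝ) (ha : 0 ≤ a) (hb : 0 ≤ b)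
    (h : a ^ 2 + b ^ 2 + 2 * a * b * form x y = 1) : HypSpace n where
  time := a * x.time + b * y.time
  space := a • x.space + b • y.space
  time_pos := by
    have px := x.time_pos
    have py := y.time_pos
    rcases ha.lt_or_eq with ha' | rfl
    · positivity
    · rcases hb.lt_or_eq with hb' | rfl
      · positivity
      · norm_num at h
  time_sq := by
    have hx := x.time_sq
    have hy := y.time_sq
    rw [norm_add_sq_real, norm_smul, norm_smul, real_inner_smul_left, real_inner_smul_right,
      mul_pow, mul_pow, Real.norm_eq_abs, Real.norm_eq_abs, sq_abs, sq_abs]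
    have e : inner ℝ x.space y.space = x.time * y.time - form x y := by simp [form]
    have nx : ‖x.space‖ ^ 2 = x.time ^ 2 - 1 := by linarith
    have ny : ‖y.space‖ ^ 2 = y.time ^ 2 - 1 := by linarith
    rw [nx, ny, e]
    linarith

theorem form_comb (x y z : HypSpace n) {a b : ℝ} (ha : 0 ≤ a) (hb : 0 ≤ b)
    (h : a ^ 2 + b ^ 2 + 2 * a * b * form x y = 1) :
    form z (comb x y a b ha hb h) = a * form z x + b * form z y := by
  simp only [form, comb, inner_add_right, real_inner_smul_right]
  ring

theorem eq_of_form_eq_one {x y : HypSpace n} (h : form x y = 1) : x = y := by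
  rw [← dist_eq_zero, dist_def, h, Real.arcosh_zero]

/-- The point at distance `t` from `x` on the geodesic segment from `x` to `y`. -/
theorem exists_point (x y : HypSpace n) {t : ℝ} (h0 : 0 ≤ t) (h1 : t ≤ dist x y) :
    ∃ z : HypSpace n, dist x z = t ∧ dist z y = dist x y - t ∧
      ∀ w, Real.sinh (dist x y) * form w z =
        Real.sinh (dist x y - t) * form w x + Real.sinh t * form w y := by
  rcases (dist_nonneg (x := x) (y := y)).eq_or_lt with hL | hL
  · have ht : t = 0 := by linarith
    subst ht
    refine ⟨x, by simp, by simp, fun w => by simp⟩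
  set L := dist x y with hLd
  have hs : 0 < Real.sinh L := Real.sinh_pos_iff.2 hL
  have ha : 0 ≤ Real.sinh (L - t) / Real.sinh L :=
    div_nonneg (Real.sinh_nonneg_iff.2 (by linarith)) hs.le
  have hb : 0 ≤ Real.sinh t / Real.sinh L := div_nonneg (Real.sinh_nonneg_iff.2 h0) hs.le
  have c1 : Real.cosh L ^ 2 = Real.sinh L ^ 2 + 1 := Real.cosh_sq L
  have c2 : Real.cosh t ^ 2 = Real.sinh t ^ 2 + 1 := Real.cosh_sq t
  have hf : form x y = Real.cosh L := (cosh_dist x y).symm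
  have key : (Real.sinh (L - t) / Real.sinh L) ^ 2 + (Real.sinh t / Real.sinh L) ^ 2 +
      2 * (Real.sinh (L - t) / Real.sinh L) * (Real.sinh t / Real.sinh L) * form x y = 1 := by
    rw [hf, Real.sinh_sub]
    field_simp
    linear_combination (Real.sinh L) ^ 2 * c2 - (Real.sinh t) ^ 2 * c1
  have fz : ∀ w, Real.sinh L * form w (comb x y _ _ ha hb key) =
      Real.sinh (L - t) * form w x + Real.sinh t * form w y := fun w => by
    rw [form_comb]; field_simp
  have hxz : form x (comb x y _ _ ha hb key) = Real.cosh t := by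
    have := fz x
    rw [form_self, hf] at this
    refine mul_left_cancel₀ hs.ne' ?_
    rw [this, Real.sinh_sub]
    ring
  have hzy : form (comb x y _ _ ha hb key) y = Real.cosh (L - t) := by
    have := fz y
    rw [form_self, form_comm y x, hf, form_comm y] at this
    refine mul_left_cancel₀ hs.ne' ?_
    rw [this, Real.cosh_sub, Real.sinh_sub]
    linear_combination (-Real.sinh t) * c1
  refine ⟨comb x y _ _ ha hb key, ?_, ?_, fz⟩
  · rw [dist_def, hxz, Real.arcosh_cosh h0]
  · rw [dist_def, hzy, Real.arcosh_cosh (by linarith)]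

/-- The points of a geodesic segment are combinations of its endpoints. -/
theorem form_of_between {x y z : HypSpace n} (h : dist x z + dist z y = dist x y)
    (w : HypSpace n) : Real.sinh (dist x y) * form w z =
      Real.sinh (dist z y) * form w x + Real.sinh (dist x z) * form w y := by
  have hd : dist z y = dist x y - dist x z := by linarith
  obtain ⟨z', h1, h2, h3⟩ := exists_point x y (t := dist x z) dist_nonneg
    (by linarith [dist_nonneg (x := z) (y := y)])
  rcases (dist_nonneg (x := x) (y := y)).eq_or_lt with hL | hL
  · have e1 : dist x z = 0 := by
      linarith [dist_nonneg (x := z) (y := y), dist_nonneg (x := x) (y := z)]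
    have e2 : dist z y = 0 := by
      linarith [dist_nonneg (x := z) (y := y), dist_nonneg (x := x) (y := z)]
    rw [e1, e2, ← hL]; simp
  have hs : 0 < Real.sinh (dist x y) := Real.sinh_pos_iff.2 hL
  -- A point of a geodesic is determined by its distances to the ends: the addition formula for sinh
  -- turns the identity for z' into `form z z' = 1`.
  have : z = z' := by
    apply eq_of_form_eq_one
    have h4 := h3 z
    rw [form_comm z x, ← cosh_dist, ← cosh_dist, ← cosh_dist, hd] at h4
    refine mul_left_cancel₀ hs.ne' ?_
    rw [← cosh_dist, h4, mul_one]
    have := Real.sinh_add (dist x y - dist x z) (dist x z)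
    rw [sub_add_cancel] at this
    linarith
  rw [this, h3 w, ← this, hd]

/-! ### Feet on convex sets -/

/-- `p` is a point of `C` that is nearest to `x`. -/
def IsFoot (C : Set (HypSpace n)) (x p : HypSpace n) : Prop :=
  p ∈ C ∧ ∀ q ∈ C, dist x p ≤ dist x q

theorem form_le_form_iff {x y z w : HypSpace n} : form x y ≤ form z w ↔ dist x y ≤ dist z w := by
  rw [dist_def, dist_def, Real.arcosh_le_arcosh] <;>
  linarith [one_le_form x y, one_le_form z w]

/-- The angle at the foot of a perpendicular to a convex set is at least a right angle. -/
theorem IsFoot.form_mul_le {C : Set (HypSpace n)} (hC : HypConvex C) {x p q : HypSpace n}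
    (hp : IsFoot C x p) (hq : q ∈ C) : form x p * form p q ≤ form x q := by
  rcases (dist_nonneg (x := p) (y := q)).eq_or_lt with hL | hL
  · have : p = q := dist_eq_zero.1 hL.symm
    subst this
    rw [form_self, mul_one]
  set L := dist p q with hLd
  have hs : 0 < Real.sinh L := Real.sinh_pos_iff.2 hL
  -- First variation: the point at distance t from p towards q lies in C, hence is no nearer to x
  -- than p. After division by sinh t the error is a multiple of tanh(t/2), which vanishes as t
  -- tends to 0.
  have key : ∀ t ∈ Ioo 0 L,
      form x p * (Real.cosh L - Real.sinh L * (Real.sinh (t / 2) / Real.cosh (t / 2))) ≤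
        form x q := by
    intro t ht
    obtain ⟨z, h1, h2, h3⟩ := exists_point p q ht.1.le ht.2.le
    have hz : z ∈ C := hC p hp.1 q hq z (by rw [h1, h2]; ring)
    have h4 := form_le_form_iff.2 (hp.2 z hz)
    have h5 := h3 x
    rw [← hLd] at h5
    have hst : 0 < Real.sinh t := Real.sinh_pos_iff.2 ht.1
    have hsh : 0 < Real.sinh (t / 2) := Real.sinh_pos_iff.2 (by linarith [ht.1])
    have hch := Real.cosh_pos (t / 2)
    have h6 : Real.sinh L * form x p ≤
        Real.sinh (L - t) * form x p + Real.sinh t * form x q := by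
      rw [← h5]; exact mul_le_mul_of_nonneg_left h4 hs.le
    have d1 : Real.sinh t = 2 * Real.sinh (t / 2) * Real.cosh (t / 2) := by
      rw [← Real.sinh_two_mul]; ring_nf
    have d2 : Real.cosh t = 1 + 2 * Real.sinh (t / 2) ^ 2 := by
      have := Real.cosh_two_mul (t / 2)
      have := Real.cosh_sq (t / 2)
      rw [show t = 2 * (t / 2) by ring, Real.cosh_two_mul, mul_div_cancel₀ _ two_ne_zero]
      linarith
    rw [Real.sinh_sub, d2] at h6
    have h7 : Real.sinh t * (form x p *
        (Real.cosh L - Real.sinh L * (Real.sinh (t / 2) / Real.cosh (t / 2)))) =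
        Real.sinh t * Real.cosh L * form x p -
          2 * Real.sinh (t / 2) ^ 2 * Real.sinh L * form x p := by
      rw [d1]; field_simp
    refine le_of_mul_le_mul_left ?_ hst
    rw [h7]; linarith
  have hlim : Filter.Tendsto (fun t : ℝ =>
      form x p * (Real.cosh L - Real.sinh L * (Real.sinh (t / 2) / Real.cosh (t / 2))))
      (nhdsWithin 0 (Ioi 0)) (nhds (form x p * form p q)) := by
    have hc : Continuous (fun t : ℝ =>
      form x p * (Real.cosh L - Real.sinh L * (Real.sinh (t / 2) / Real.cosh (t / 2)))) := by
      have h1 : Continuous fun t : ℝ => Real.sinh (t / 2) := Real.continuous_sinh.comp (by fun_prop)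
      have h2 : Continuous fun t : ℝ => Real.cosh (t / 2) := Real.continuous_cosh.comp (by fun_prop)
      have h3 := h1.div h2 (fun t => (Real.cosh_pos _).ne')
      exact continuous_const.mul (continuous_const.sub (continuous_const.mul h3))
    have := (hc.tendsto 0).mono_left (nhdsWithin_le_nhds (s := Ioi 0))
    simpa [hLd, cosh_dist] using this
  refine le_of_tendsto hlim ?_
  filter_upwards [Ioo_mem_nhdsGT hL] with t ht using key t ht

/-- A coarse Pythagoras: with e^t/2 ≤ cosh t ≤ e^t, the bound cosh a · cosh b ≤ cosh c becomes a + b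
≤ c + log 4. A detour through the foot is almost a geodesic. -/
theorem IsFoot.dist_add_le {C : Set (HypSpace n)} (hC : HypConvex C) {x p q : HypSpace n}
    (hp : IsFoot C x p) (hq : q ∈ C) : dist x p + dist p q ≤ dist x q + 3 / 2 := by
  have h := hp.form_mul_le hC hq
  rw [← cosh_dist, ← cosh_dist, ← cosh_dist] at h
  have lo : ∀ t : ℝ, Real.exp t / 2 ≤ Real.cosh t := fun t => by
    rw [Real.cosh_eq]; have := Real.exp_pos (-t); linarith
  have up : ∀ t : ℝ, 0 ≤ t → Real.cosh t ≤ Real.exp t := fun t ht => by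
    rw [Real.cosh_eq]; have := Real.exp_le_exp.2 (show -t ≤ t by linarith); linarith
  have h1 := mul_le_mul (lo (dist x p)) (lo (dist p q)) (by positivity) (Real.cosh_pos _).le
  have h2 := up (dist x q) dist_nonneg
  have h3 : Real.exp (dist x p + dist p q) ≤ Real.exp (Real.log 4 + dist x q) := by
    rw [Real.exp_add, Real.exp_add, Real.exp_log (by norm_num)]
    linarith
  have := Real.exp_le_exp.1 h3
  have := log_four_le
  linarith

/-- Two points at the same distance from a convex set are much farther apart than their feet. -/
theorem IsFoot.sinh_le {C : Set (HypSpace n)} (hC : HypConvex C) {x p y q : HypSpace n}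
    (hp : IsFoot C x p) (hq : IsFoot C y q) (h : dist x p = dist y q) :
    Real.cosh (dist x p) * Real.sinh (dist p q / 2) ≤ Real.sinh (dist x y / 2) := by
  rcases (dist_nonneg (x := p) (y := q)).eq_or_lt with hL | hL
  · rw [← hL]; simpa using sinh_half_nonneg x y
  have hs : 0 < Real.sinh (dist p q / 2) := Real.sinh_pos_iff.2 (by linarith)
  have h1 := hp.form_mul_le hC hq.1
  have h2 := hq.form_mul_le hC hp.1
  -- Ptolemy for a quadrilateral with equal legs. The angles at the feet bound the product of the
  -- diagonals below by (P Q - 1)/2, where P and Q are `form x p` and `form p q`. The legs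
  -- contribute (P - 1)/2, and the difference P (Q - 1)/2 is P sinh²(d(p, q)/2).
  have hpt := ptolemy x y q p
  have e : form y q = form x p := by rw [← cosh_dist, ← cosh_dist, h]
  rw [form_comm q p, e] at h2
  have f1 := form_sub_one x q
  have f2 := form_sub_one y p
  have f3 := form_sub_one x p
  have f4 := form_sub_one p q
  rw [dist_comm q p, ← h] at hpt
  rw [cosh_dist]
  have key : ∀ u v m : ℝ, 0 ≤ u → 0 ≤ v → m ≤ 2 * u ^ 2 → m ≤ 2 * v ^ 2 → m ≤ 2 * (u * v) := by
    intro u v m hu hv h1 h2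
    rcases le_total u v with h | h <;> nlinarith
  have := key _ _ (form x p * form p q - 1) (sinh_half_nonneg x q) (sinh_half_nonneg y p)
    (by linarith) (by linarith)
  refine le_of_mul_le_mul_right ?_ hs
  have h5 : 2 * (form x p * Real.sinh (dist p q / 2) * Real.sinh (dist p q / 2)) =
      form x p * (form p q - 1) := by rw [f4]; ring
  nlinarith

/-- Neighbourhoods of convex sets are coarsely convex. -/
theorem dist_foot_between {C : Set (HypSpace n)} (hC : HypConvex C) {x y z p q w : HypSpace n}
    {D : ℝ} (hp : p ∈ C) (hq : q ∈ C) (hx : dist x p ≤ D) (hy : dist y q ≤ D)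
    (hz : dist x z + dist z y = dist x y) (hw : IsFoot C z w) : dist z w ≤ D + 9 / 4 := by
  -- With z on [x, y], and the detours from z through w to p and to q almost geodesic, either
  -- alternative gives 2 d(z, w) ≤ 2D + 3 + 3/2.
  have h4 := four_point z w x y
  have o1 := hw.dist_add_le hC hp
  have o2 := hw.dist_add_le hC hq
  have t1 := dist_triangle w p x
  have t2 := dist_triangle w q y
  have t3 := dist_triangle z x p
  have t4 := dist_triangle z y q
  rw [dist_comm p x] at t1
  rw [dist_comm q y] at t2
  have := dist_comm x z
  rcases max_cases (dist z x + dist w y) (dist z y + dist w x) with ⟨h, -⟩ | ⟨h, -⟩ <;>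
    rw [h] at h4 <;> linarith

/-- Two long geodesics that start at nearby points far above a convex set and do not end higher
than they start come close together: the end of the second may be pushed to a point of the first
with a gain. -/
theorem exists_shortcut {C : Set (HypSpace n)} (hC : HypConvex C)
    {a₁ a₂ b₁ b₂ p₁ p₂ q₁ q₂ : HypSpace n} {c R : ℝ}
    (hp₁ : IsFoot C a₁ p₁) (hp₂ : IsFoot C a₂ p₂) (hq₁ : IsFoot C b₁ q₁) (hq₂ : IsFoot C b₂ q₂)
    (hc : dist a₁ a₂ ≤ c) (hR : 5 * c + 20 ≤ R) (h₁ : R - c ≤ dist a₁ p₁)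
    (h₂ : R - c ≤ dist a₂ p₂) (h₁' : dist b₁ q₁ ≤ R) (h₂' : dist b₂ q₂ ≤ R)
    (l₁ : 5 * c + 17 ≤ dist a₁ b₁) (l₂ : 5 * c + 17 ≤ dist a₂ b₂) :
    ∃ z, dist a₂ z + dist z b₂ = dist a₂ b₂ ∧ dist z b₁ < dist a₁ b₁ := by
  have hc0 : 0 ≤ c := dist_nonneg.trans hc
  -- The right side is twice the Gromov product of b and p at a. It is large because the geodesic
  -- from a to b is long and b is at most c higher than a: such a geodesic has to begin along the
  -- perpendicular from a.
  have cut : ∀ {a b p q : HypSpace n}, IsFoot C a p → IsFoot C b q → R - c ≤ dist a p →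
      dist b q ≤ R → 5 * c + 17 ≤ dist a b → 4 * c + 14 ≤ dist a b + dist a p - dist b p := by
    intro a b p q hp hq h1 h2 l
    have f := four_point b p a q
    have o1 := hp.dist_add_le hC hq.1
    have o2 := hq.dist_add_le hC hp.1
    have t := dist_triangle b q p
    rw [dist_comm q p] at t o2
    rw [dist_comm b a, dist_comm p a] at f
    rcases max_cases (dist a b + dist p q) (dist b q + dist a p) with ⟨h, -⟩ | ⟨h, -⟩ <;>
      rw [h] at f <;> linarith
  have c1 := cut hp₁ hq₁ h₁ h₁' l₁
  have c2 := cut hp₂ hq₂ h₂ h₂' l₂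
  have hpp : dist p₁ p₂ ≤ 3 := by
    have f := four_point a₁ p₂ p₁ a₂
    have o1 := hp₁.dist_add_le hC hp₂.1
    have o2 := hp₂.dist_add_le hC hp₁.1
    rw [dist_comm p₂ p₁] at f o2
    rw [dist_comm p₂ a₂] at f
    rw [dist_comm p₁ a₂] at f
    rcases max_cases (dist a₁ p₁ + dist a₂ p₂) (dist a₁ a₂ + dist p₁ p₂) with ⟨h, -⟩ | ⟨h, -⟩ <;>
      rw [h] at f <;> linarith
  -- The four-point inequality in terms of doubled Gromov products at a₁. It is used twice, along
  -- p₁, p₂, b₂ and then b₁, p₁, b₂; each use costs 3, and changing the base point from a₂ to a₁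
  -- costs 2c.
  have gromov : ∀ x y z : HypSpace n,
      min (dist a₁ x + dist a₁ y - dist x y) (dist a₁ y + dist a₁ z - dist y z) - 3 ≤
        dist a₁ x + dist a₁ z - dist x z := by
    intro x y z
    have f := four_point x z a₁ y
    rw [dist_comm x a₁, dist_comm z a₁, dist_comm z y] at f
    rcases max_cases (dist a₁ x + dist y z) (dist x y + dist a₁ z) with ⟨h, -⟩ | ⟨h, -⟩ <;>
      rw [h] at f
    · have := min_le_right (dist a₁ x + dist a₁ y - dist x y) (dist a₁ y + dist a₁ z - dist y z)
      linarith
    · have := min_le_left (dist a₁ x + dist a₁ y - dist x y) (dist a₁ y + dist a₁ z - dist y z)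
      linarith
  have t1 := dist_triangle a₂ a₁ p₂
  have t2 := dist_triangle a₂ a₁ b₂
  have t5 := dist_triangle a₁ a₂ b₂
  have t6 := dist_triangle a₂ a₁ b₁
  rw [dist_comm a₂ a₁] at t1 t2 t6
  have g1 : 2 * c + 11 ≤ dist a₁ p₁ + dist a₁ b₂ - dist p₁ b₂ := by
    have g := gromov p₁ p₂ b₂
    have := le_min (show 2 * c + 14 ≤ dist a₁ p₁ + dist a₁ p₂ - dist p₁ p₂ by linarith)
      (show 2 * c + 14 ≤ dist a₁ p₂ + dist a₁ b₂ - dist p₂ b₂ by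
        rw [dist_comm p₂ b₂]; linarith)
    linarith
  have g2 : 2 * c + 8 ≤ dist a₁ b₁ + dist a₁ b₂ - dist b₁ b₂ := by
    have g := gromov b₁ p₁ b₂
    have := le_min (show 2 * c + 11 ≤ dist a₁ b₁ + dist a₁ p₁ - dist b₁ p₁ by linarith) g1
    linarith
  -- The distance c + 4 balances the two alternatives below. In one, the product 2c + 8 pays for the
  -- c + 4 to z and for the c between a₁ and a₂; in the other, c + 4 is saved on the way and c is
  -- paid. Both gain 1 after the error 3.
  obtain ⟨z, z1, z2, -⟩ := exists_point a₂ b₂ (t := c + 4) (by linarith) (by linarith)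
  refine ⟨z, by rw [z1, z2]; ring, ?_⟩
  have f := four_point z b₁ a₂ b₂
  rw [dist_comm z a₂, z1, z2, dist_comm b₁ a₂] at f
  rcases max_cases (c + 4 + dist b₁ b₂) (dist a₂ b₂ - (c + 4) + dist a₂ b₁) with ⟨h, -⟩ | ⟨h, -⟩ <;>
    rw [h] at f <;> linarith

end HypSpace

/-! ### The topology of hyperbolic space -/

namespace HypSpace

variable {n : ℕ}

/-- The point of the hyperboloid over a point of Euclidean space. -/
noncomputable def ofSpace (s : EuclideanSpace ℝ (Fin n)) : HypSpace n where
  time := Real.sqrt (1 + ‖s‖ ^ 2)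
  space := s
  time_pos := Real.sqrt_pos.2 (by positivity)
  time_sq := Real.sq_sqrt (by positivity)

theorem ofSpace_space (x : HypSpace n) : ofSpace x.space = x := by
  refine HypSpace.ext ?_ rfl
  simp only [ofSpace]
  rw [← x.time_sq, Real.sqrt_sq x.time_pos.le]

/-- The topology is that of the metric, so continuity of the coordinates has to be read off from
distances: `time` is the form against the origin, and the form against the point over s recovers the
inner product with s. -/
theorem continuous_form (y : HypSpace n) : Continuous fun x : HypSpace n => form x y := by
  simp only [← cosh_dist]
  exact Real.continuous_cosh.comp (continuous_id.dist continuous_const)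

theorem continuous_time : Continuous (time : HypSpace n → ℝ) := by
  have h := continuous_form (ofSpace (0 : EuclideanSpace ℝ (Fin n)))
  simpa [form, ofSpace] using h

theorem continuous_inner_space (s : EuclideanSpace ℝ (Fin n)) :
    Continuous fun x : HypSpace n => (inner ℝ x.space s : ℝ) := by
  have h : Continuous fun x : HypSpace n => x.time * (ofSpace s).time - form x (ofSpace s) :=
    (continuous_time.mul continuous_const).sub (continuous_form _)
  simpa [form, ofSpace] using h

theorem continuous_space : Continuous (space : HypSpace n → EuclideanSpace ℝ (Fin n)) := by
  rw [(PiLp.homeomorph 2 (fun _ : Fin n => ℝ)).comp_continuous_iff.symm, continuous_pi_iff]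
  intro i
  have h := continuous_inner_space (EuclideanSpace.single i (1 : ℝ))
  simpa [PiLp.homeomorph, EuclideanSpace.inner_single_right] using h

theorem continuous_ofSpace :
    Continuous (ofSpace : EuclideanSpace ℝ (Fin n) → HypSpace n) := by
  rw [continuous_iff_continuousAt]
  intro s
  rw [ContinuousAt, tendsto_iff_dist_tendsto_zero]
  have hc : Continuous fun t : EuclideanSpace ℝ (Fin n) =>
      (⟨form (ofSpace t) (ofSpace s), one_le_form _ _⟩ : Ici (1 : ℝ)) := by
    refine Continuous.subtype_mk ?_ _
    simp only [form, ofSpace]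
    fun_prop
  have hd : Continuous fun t : EuclideanSpace ℝ (Fin n) => dist (ofSpace t) (ofSpace s) :=
    (continuousOn_iff_continuous_domRestrict.1 Real.continuousOn_arcosh).comp hc
  simpa using hd.tendsto s

/-- Vertical projection of the hyperboloid to Euclidean space. -/
noncomputable def spaceHomeomorph : HypSpace n ≃ₜ EuclideanSpace ℝ (Fin n) where
  toFun := space
  invFun := ofSpace
  left_inv := ofSpace_space
  right_inv _ := rfl
  continuous_toFun := continuous_space
  continuous_invFun := continuous_ofSpace

/-- The time coordinate is cosh of the distance to the origin and dominates the norm of the space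
part. Properness provides nearest points on closed sets and the compactness behind the Zorn argument
for the hull. -/
instance : ProperSpace (HypSpace n) where
  isCompact_closedBall x r := by
    have hsub : Metric.closedBall x r ⊆
        spaceHomeomorph ⁻¹' Metric.closedBall 0 (Real.cosh (r + dist x (ofSpace 0))) := by
      intro y hy
      rw [Metric.mem_closedBall] at hy
      have h1 : dist y (ofSpace 0) ≤ r + dist x (ofSpace 0) := by
        linarith [dist_triangle y x (ofSpace 0)]
      have h2 : form y (ofSpace 0) ≤ Real.cosh (r + dist x (ofSpace 0)) := by
        rw [← cosh_dist]
        exact Real.cosh_le_cosh.2 (by rwa [abs_of_nonneg dist_nonneg,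
          abs_of_nonneg (dist_nonneg.trans h1)])
      have h3 : form y (ofSpace 0) = y.time := by simp [form, ofSpace]
      have h4 := y.time_sq
      have h5 := y.time_pos
      rw [mem_preimage, mem_closedBall_zero_iff]
      have h6 : ‖y.space‖ ≤ y.time := by
        refine (pow_le_pow_iff_left₀ (norm_nonneg _) h5.le two_ne_zero).1 ?_
        linarith
      exact h6.trans (h3 ▸ h2)
    refine IsCompact.of_isClosed_subset ?_ Metric.isClosed_closedBall hsub
    exact spaceHomeomorph.isCompact_preimage.2 (isCompact_closedBall _ _)

instance : SimplyConnectedSpace (HypSpace n) :=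
  haveI := spaceHomeomorph (n := n).contractibleSpace
  inferInstance

/-- The geodesic path, as a map that stretches distances by the constant factor `dist x y`. -/
theorem exists_geodesic (x y : HypSpace n) :
    ∃ c : Path x y, ∀ s t : I, dist (c s) (c t) = dist x y * dist s t := by
  set L := dist x y with hLd
  have h : ∀ t : I, ∃ z : HypSpace n, dist x z = t * L ∧ dist z y = L - t * L ∧
      ∀ w, Real.sinh L * form w z =
        Real.sinh (L - t * L) * form w x + Real.sinh (t * L) * form w y := fun t =>
    exists_point x y (mul_nonneg t.2.1 dist_nonneg) (mul_le_of_le_one_left dist_nonneg t.2.2)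
  choose z z1 z2 z3 using h
  have hd : ∀ s t : I, dist (z s) (z t) = L * dist s t := by
    intro s t
    rcases (dist_nonneg (x := x) (y := y)).eq_or_lt with hL | hL
    · have e : ∀ t, z t = x := fun t => by
        have := z1 t
        rw [hLd, ← hL, mul_zero, dist_eq_zero] at this
        exact this.symm
      rw [e, e, hLd, ← hL]; simp
    have hs : 0 < Real.sinh L := Real.sinh_pos_iff.2 hL
    have hf : form (z s) (z t) = Real.cosh (s * L - t * L) := by
      refine mul_left_cancel₀ hs.ne' ?_
      rw [z3 t, form_comm _ x, ← cosh_dist, ← cosh_dist, z1, z2, Real.sinh_sub, Real.cosh_sub,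
        Real.cosh_sub]
      ring
    rw [dist_def, hf, ← Real.cosh_abs, Real.arcosh_cosh (abs_nonneg _), ← sub_mul, abs_mul,
      abs_of_pos hL, Subtype.dist_eq, Real.dist_eq, mul_comm]
  have hc : Continuous z := by
    refine LipschitzWith.continuous (K := ⟨L, dist_nonneg⟩) (LipschitzWith.of_dist_le_mul ?_)
    intro s t
    exact (hd s t).le
  refine ⟨⟨⟨z, hc⟩, ?_, ?_⟩, hd⟩
  · have := z1 0
    simpa [eq_comm] using this
  · have := z2 1
    simpa using this

theorem eVariationOn_le_of_dist_le {X : Type*} [PseudoMetricSpace X] {c : I → X} {L : ℝ}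
    (hL : 0 ≤ L) (h : ∀ s t : I, dist (c s) (c t) ≤ L * dist s t) :
    eVariationOn c univ ≤ ENNReal.ofReal L := by
  have hl : LipschitzWith ⟨L, hL⟩ c := LipschitzWith.of_dist_le_mul h
  have h1 := hl.lipschitzOnWith (s := univ) |>.comp_eVariationOn_le (g := (id : I → I))
    (s := univ) (mapsTo_univ _ _)
  have h2 : eVariationOn (id : I → I) univ ≤ 1 := by
    have h3 : eVariationOn (id : I → I) univ = eVariationOn (fun t : I => (t : ℝ)) univ := rfl
    rw [h3]
    have := (show MonotoneOn (fun t : I => (t : ℝ)) univ from fun a _ b _ h => h).eVariationOn_eq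
      (mem_univ 0) (mem_univ 1)
    have e : (univ : Set I) ∩ Icc 0 1 = univ := by
      ext t; exact ⟨fun _ => mem_univ _, fun _ => ⟨mem_univ _, t.2⟩⟩
    rw [e] at this
    simpa using this.le
  calc eVariationOn c univ ≤ _ := h1
    _ ≤ _ * 1 := by gcongr
    _ = ENNReal.ofReal L := by
      rw [mul_one, ENNReal.ofReal, Real.toNNReal_of_nonneg hL]; rfl

/-! ### Distance from a closed convex set -/

theorem exists_isFoot {C : Set (HypSpace n)} (hne : C.Nonempty) (hcl : IsClosed C)
    (x : HypSpace n) : ∃ p, IsFoot C x p := by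
  obtain ⟨p, hp, h⟩ := hcl.exists_infDist_eq_dist hne x
  exact ⟨p, hp, fun q hq => h ▸ Metric.infDist_le_dist_of_mem hq⟩

/-- The Cauchy-Schwarz inequality on the orthogonal complement of `q`, for the components of `t`
and of the normal vector `form z p • p - z` at `p`. -/
theorem gram_functional (p z q t : HypSpace n) :
    (form z p * form p t - form z t - (form z p * form p q - form z q) * form q t) ^ 2 ≤
      (form z p ^ 2 - 1 + (form z p * form p q - form z q) ^ 2) * (form q t ^ 2 - 1) := by
  have E : ∀ x y : HypSpace n, inner ℝ x.space y.space = x.time * y.time - form x y := by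
    intro x y; simp [form]
  obtain ⟨P, hP⟩ : ∃ P, P = form z p := ⟨_, rfl⟩
  obtain ⟨h, hh⟩ : ∃ h, h = P * form p q - form z q := ⟨_, rfl⟩
  obtain ⟨τ, hτ⟩ : ∃ τ, τ = form q t := ⟨_, rfl⟩
  have key : ∀ a b : ℝ, 0 ≤ a * a * (P ^ 2 - 1 + h ^ 2) +
      2 * (a * b) * (h * τ - (P * form p t - form z t)) + b * b * (τ ^ 2 - 1) := by
    intro a b
    have l := lorentz_nonneg q
      (a * (P * p.time - z.time - h * q.time) + b * (t.time - τ * q.time))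
      (a • (P • p.space - z.space - h • q.space) + b • (t.space - τ • q.space)) (by
        simp only [inner_add_left, inner_sub_left, real_inner_smul_left, E, form_self]
        rw [form_comm t q, ← hτ]
        linear_combination (-a) * hh)
    rw [← real_inner_self_eq_norm_sq] at l
    simp only [inner_add_left, inner_sub_left, real_inner_smul_left, inner_add_right,
      inner_sub_right, real_inner_smul_right, E, form_self] at l
    rw [form_comm q p, form_comm p z, form_comm q z, form_comm t p, form_comm t z, form_comm t q,
      ← hP, ← hτ] at l
    have e : form z q = P * form p q - h := by linarith
    rw [e] at l
    linarith [l]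
  rw [← hP, ← hh, ← hτ]
  have d := discrim_le_zero (a := P ^ 2 - 1 + h ^ 2)
    (b := 2 * (h * τ - (P * form p t - form z t))) (c := τ ^ 2 - 1)
    (fun s => by have := key s 1; linarith)
  unfold discrim at d
  linarith

/-- Closed neighbourhoods of closed convex sets are convex. -/
theorem hypConvex_neighborhood {C : Set (HypSpace n)} (hne : C.Nonempty) (hcl : IsClosed C)
    (hC : HypConvex C) (r : ℝ) : HypConvex {x | ∃ q ∈ C, dist x q ≤ r} := by
  rintro x ⟨qx, hqx, hx⟩ y ⟨qy, hqy, hy⟩ z hz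
  obtain ⟨p, hp⟩ := exists_isFoot hne hcl z
  refine ⟨p, hp.1, ?_⟩
  by_contra! hlt
  have hr : 0 ≤ r := dist_nonneg.trans hx
  set P := form z p with hP
  have hPc : P = Real.cosh (dist z p) := (cosh_dist z p).symm
  set S := Real.sinh (dist z p) with hS
  have hS0 : 0 < S := Real.sinh_pos_iff.2 (by linarith)
  have hPS : P ^ 2 = S ^ 2 + 1 := by rw [hPc, hS, Real.cosh_sq]
  have hP0 : 0 < P := by rw [hPc]; exact Real.cosh_pos _
  -- the linear functional `t ↦ P * form p t - form z t` measures the height above `C`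
  have bound : ∀ t q : HypSpace n, q ∈ C → dist t q ≤ r →
      P * form p t - form z t ≤ S * Real.sinh r := by
    intro t q hq ht
    have hh := hp.form_mul_le hC hq
    set h := P * form p q - form z q with hh'
    have hh0 : h ≤ 0 := by linarith
    set τ := form q t with hτ
    have hτ' : τ = Real.cosh (dist t q) := by rw [cosh_dist, form_comm]
    have gram := gram_functional p z q t
    rw [← hP, ← hτ, ← hh', show P ^ 2 - 1 = S ^ 2 by linarith] at gram
    have hst : τ ^ 2 - 1 = Real.sinh (dist t q) ^ 2 := by rw [hτ', Real.cosh_sq]; ring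
    set m := Real.sinh (dist t q) with hm
    have hm0 : 0 ≤ m := Real.sinh_nonneg_iff.2 dist_nonneg
    have hmτ : m ≤ τ := by rw [hτ']; exact (Real.sinh_lt_cosh _).le
    have hmr : m ≤ Real.sinh r := Real.sinh_le_sinh.2 ht
    rw [hst] at gram
    -- Since h ≤ 0, S² + h² ≤ (S - h)². The functional at t is then at most S m + h (τ - m), hence
    -- at most S m because m ≤ τ.
    have h1 : (P * form p t - form z t - h * τ) ^ 2 ≤ ((S - h) * m) ^ 2 := by
      refine gram.trans ?_
      rw [mul_pow]
      gcongr
      nlinarith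
    have h2 := abs_le_of_sq_le_sq' h1 (mul_nonneg (by linarith) hm0)
    nlinarith [h2.2]
  have hx' := bound x qx hqx hx
  have hy' := bound y qy hqy hy
  have b1 := form_of_between hz p
  have b2 := form_of_between hz z
  rw [form_self, mul_one] at b2
  have hxy : dist x z + dist z y ≠ 0 := by
    intro h
    have h1 : dist x z = 0 := by
      linarith [dist_nonneg (x := x) (y := z), dist_nonneg (x := z) (y := y)]
    rw [dist_eq_zero] at h1
    rw [h1] at hx'
    rw [form_self, form_comm p z, ← hP] at hx'
    have : Real.sinh r < S := Real.sinh_lt_sinh.2 hlt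
    nlinarith
  have hL : 0 < dist x y := by
    rw [← hz]; exact lt_of_le_of_ne (by positivity) (Ne.symm hxy)
  have hs1 : 0 ≤ Real.sinh (dist z y) := Real.sinh_nonneg_iff.2 dist_nonneg
  have hs2 : 0 ≤ Real.sinh (dist x z) := Real.sinh_nonneg_iff.2 dist_nonneg
  have hsum : Real.sinh (dist z y) + Real.sinh (dist x z) ≤ Real.sinh (dist x y) := by
    rw [← hz, Real.sinh_add]
    have := Real.one_le_cosh (dist x z)
    have := Real.one_le_cosh (dist z y)
    nlinarith
  have hsp : 0 < Real.sinh (dist x y) := Real.sinh_pos_iff.2 hL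
  -- At z the functional equals P² - 1 = S². As z combines x and y with coefficients of sum at most
  -- one, S² ≤ S sinh r, although sinh r < S.
  have e : Real.sinh (dist x y) * S ^ 2 =
      Real.sinh (dist z y) * (P * form p x - form z x) +
        Real.sinh (dist x z) * (P * form p y - form z y) := by
    rw [form_comm p z, ← hP] at b1
    have : Real.sinh (dist x y) * S ^ 2 = P * (Real.sinh (dist x y) * P) -
      Real.sinh (dist x y) := by linear_combination (-Real.sinh (dist x y)) * hPS
    rw [this, b1]
    linear_combination (-1) * b2
  have hlt' : Real.sinh r < S := Real.sinh_lt_sinh.2 hlt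
  have hr' : 0 ≤ Real.sinh r := Real.sinh_nonneg_iff.2 hr
  have u : Real.sinh (dist x y) * S ^ 2 ≤ Real.sinh (dist x y) * (S * Real.sinh r) := by
    rw [e]
    calc _ ≤ Real.sinh (dist z y) * (S * Real.sinh r) + Real.sinh (dist x z) * (S * Real.sinh r) := by
          gcongr
      _ = (Real.sinh (dist z y) + Real.sinh (dist x z)) * (S * Real.sinh r) := by ring
      _ ≤ _ := by gcongr
  have := le_of_mul_le_mul_left u hsp
  nlinarith

end HypSpace

/-! ### The thickened convex hull -/

section Hull

variable {n : ℕ} {Γ : Subgroup (HypSpace n ≃ᵢ HypSpace n)} {ε : ℝ}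

open HypSpace

/-- The family of sets whose intersection is the thickened convex hull. -/
structure IsHullCandidate (Γ : Subgroup (HypSpace n ≃ᵢ HypSpace n)) (ε : ℝ)
    (C : Set (HypSpace n)) : Prop where
  nonempty : C.Nonempty
  closed : IsClosed C
  convex : HypConvex C
  invariant : ∀ γ ∈ Γ, ∀ x ∈ C, γ x ∈ C
  thin_subset : thinSet Γ ε ⊆ C

theorem mem_thickHull {x : HypSpace n} :
    x ∈ thickHull Γ ε ↔ ∀ C, IsHullCandidate Γ ε C → x ∈ C :=
  ⟨fun h C hC => h C ⟨hC.1, hC.2, hC.3, hC.4, hC.5⟩,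
    fun h C hC => h C ⟨hC.1, hC.2.1, hC.2.2.1, hC.2.2.2.1, hC.2.2.2.2⟩⟩

theorem isOpen_thinSet : IsOpen (thinSet Γ ε) := by
  have : thinSet Γ ε = ⋃ γ ∈ {γ | γ ∈ Γ ∧ γ ≠ 1}, {x | dist x (γ x) < ε} := by
    ext x; simp [thinSet, and_assoc]
  rw [this]
  exact isOpen_biUnion fun γ _ =>
    isOpen_lt (continuous_id.dist γ.isometry.continuous) continuous_const

theorem HypSpace.IsFoot.map {C : Set (HypSpace n)} {γ : HypSpace n ≃ᵢ HypSpace n}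
    (hγ : ∀ x ∈ C, γ x ∈ C) (hγ' : ∀ x ∈ C, γ⁻¹ x ∈ C) {x p : HypSpace n} (hp : IsFoot C x p) :
    IsFoot C (γ x) (γ p) := by
  refine ⟨hγ p hp.1, fun q hq => ?_⟩
  rw [γ.isometry.dist_eq]
  refine (hp.2 _ (hγ' q hq)).trans_eq ?_
  rw [← γ.isometry.dist_eq]
  congr 1
  exact γ.apply_symm_apply q

namespace IsHullCandidate

variable {C : Set (HypSpace n)} (hC : IsHullCandidate Γ ε C)
include hC

theorem isFoot_map {γ : HypSpace n ≃ᵢ HypSpace n} (hγ : γ ∈ Γ) {x p : HypSpace n}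
    (hp : IsFoot C x p) : IsFoot C (γ x) (γ p) :=
  hp.map (hC.invariant γ hγ) (hC.invariant _ (Γ.inv_mem hγ))

/-- The foot of an exterior point is not thin. -/
theorem le_dist_foot {γ : HypSpace n ≃ᵢ HypSpace n} (hγ : γ ∈ Γ) (h1 : γ ≠ 1)
    {x p : HypSpace n} (hp : IsFoot C x p) (hx : 0 < dist x p) : ε ≤ dist p (γ p) := by
  by_contra! hlt
  -- The thin set is open and contained in C, so a thin foot would be interior to C, and a small
  -- step towards x would give a nearer point of C.
  have hthin : p ∈ thinSet Γ ε := ⟨γ, hγ, h1, hlt⟩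
  obtain ⟨r, hr, hball⟩ := Metric.isOpen_iff.1 isOpen_thinSet p hthin
  set t := min (r / 2) (dist x p) with ht
  have ht0 : 0 < t := lt_min (by linarith) hx
  obtain ⟨z, z1, z2, -⟩ := exists_point p x (t := t) ht0.le
    (by rw [dist_comm p x]; exact min_le_right _ _)
  have hz : z ∈ C := hC.thin_subset (hball (by
    rw [Metric.mem_ball, dist_comm, z1]
    exact (min_le_left _ _).trans_lt (by linarith)))
  have := hp.2 z hz
  rw [dist_comm x z, z2, dist_comm p x] at this
  linarith

/-- Points far from the hull are moved a lot by nontrivial elements. -/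
theorem cosh_mul_sinh_le {γ : HypSpace n ≃ᵢ HypSpace n} (hγ : γ ∈ Γ) (h1 : γ ≠ 1)
    {x p : HypSpace n} (hp : IsFoot C x p) (hx : 0 < dist x p) :
    Real.cosh (dist x p) * Real.sinh (ε / 2) ≤ Real.sinh (dist x (γ x) / 2) := by
  have h := hp.sinh_le hC.convex (hC.isFoot_map hγ hp) (by rw [γ.isometry.dist_eq])
  refine le_trans ?_ h
  have := hC.le_dist_foot hγ h1 hp hx
  have := Real.cosh_pos (dist x p)
  gcongr
  exact Real.sinh_le_sinh.2 (by linarith)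

omit hC in
-- The displacement of x by one fixed γ bounds its height above every candidate at once, by h ≤ sinh
-- h < cosh h. This keeps a chain of candidates from escaping to infinity.
theorem exists_radius (hε : 0 < ε) {γ : HypSpace n ≃ᵢ HypSpace n} (hγ : γ ∈ Γ) (h1 : γ ≠ 1)
    (x : HypSpace n) :
    ∃ R, ∀ C, IsHullCandidate Γ ε C → (C ∩ Metric.closedBall x R).Nonempty := by
  have hs : 0 < Real.sinh (ε / 2) := Real.sinh_pos_iff.2 (by linarith)
  have hs' : 0 ≤ Real.sinh (dist x (γ x) / 2) := sinh_half_nonneg _ _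
  refine ⟨Real.sinh (dist x (γ x) / 2) / Real.sinh (ε / 2), fun C hC => ?_⟩
  obtain ⟨p, hp⟩ := exists_isFoot hC.nonempty hC.closed x
  refine ⟨p, hp.1, ?_⟩
  rw [Metric.mem_closedBall, dist_comm]
  rcases (dist_nonneg (x := x) (y := p)).eq_or_lt with h | h
  · rw [← h]; positivity
  rw [le_div_iff₀ hs]
  refine le_trans ?_ (hC.cosh_mul_sinh_le hγ h1 hp h)
  gcongr
  exact (Real.self_le_sinh_iff.2 h.le).trans (Real.sinh_lt_cosh _).le

/-- If C is minimal, it must equal this sublevel set for each of its points x, so the distance to C'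
is constant on C. -/
theorem inter_neighborhood {C' : Set (HypSpace n)} (hC' : IsHullCandidate Γ ε C') {x : HypSpace n}
    (hthin : thinSet Γ ε = ∅) (hx : x ∈ C) :
    IsHullCandidate Γ ε (C ∩ {y | ∃ q ∈ C', dist y q ≤ Metric.infDist x C'}) where
  nonempty := by
    obtain ⟨q, hq, h⟩ := hC'.closed.exists_infDist_eq_dist hC'.nonempty x
    exact ⟨x, hx, q, hq, h.ge⟩
  closed := by
    refine hC.closed.inter ?_
    have : {y | ∃ q ∈ C', dist y q ≤ Metric.infDist x C'} =
        {y | Metric.infDist y C' ≤ Metric.infDist x C'} := by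
      ext y
      constructor
      · rintro ⟨q, hq, h⟩
        exact (Metric.infDist_le_dist_of_mem hq).trans h
      · intro h
        obtain ⟨q, hq, h'⟩ := hC'.closed.exists_infDist_eq_dist hC'.nonempty y
        exact ⟨q, hq, h' ▸ h⟩
    rw [this]
    exact isClosed_le (Metric.continuous_infDist_pt _) continuous_const
  convex := by
    intro a ha b hb z hz
    exact ⟨hC.convex a ha.1 b hb.1 z hz,
      hypConvex_neighborhood hC'.nonempty hC'.closed hC'.convex _ a ha.2 b hb.2 z hz⟩
  invariant := by
    rintro γ hγ a ⟨ha, q, hq, h⟩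
    exact ⟨hC.invariant γ hγ a ha, γ q, hC'.invariant γ hγ q hq, by rwa [γ.isometry.dist_eq]⟩
  thin_subset := by simp [hthin]

end IsHullCandidate

/-- Each of two minimal candidates is at constant distance from the other, so a point x of A and its
foot q on B are feet of one another. Comparing the displacements of x and q by γ in both directions
forces cosh d(x, q) = 1; freeness makes these displacements positive. -/
theorem subset_of_minimal (hΓ : IsHyperbolicManifoldGroup Γ) {γ : HypSpace n ≃ᵢ HypSpace n}
    (hγ : γ ∈ Γ) (h1 : γ ≠ 1) (hthin : thinSet Γ ε = ∅) {A B : Set (HypSpace n)}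
    (hA : Minimal (IsHullCandidate Γ ε) A) (hB : Minimal (IsHullCandidate Γ ε) B) : A ⊆ B := by
  have const : ∀ {A B : Set (HypSpace n)}, Minimal (IsHullCandidate Γ ε) A →
      Minimal (IsHullCandidate Γ ε) B → ∀ x ∈ A, ∀ y ∈ A, Metric.infDist y B ≤
        Metric.infDist x B := by
    intro A B hA hB x hx y hy
    obtain ⟨-, q, hq, h⟩ := hA.2 (hA.1.inter_neighborhood hB.1 hthin hx) inter_subset_left hy
    exact (Metric.infDist_le_dist_of_mem hq).trans h
  intro x hx
  obtain ⟨q, hq, hxq⟩ := hB.1.closed.exists_infDist_eq_dist hB.1.nonempty x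
  obtain ⟨x', hx', hqx'⟩ := hA.1.closed.exists_infDist_eq_dist hA.1.nonempty q
  have e1 : dist x q ≤ dist q x' := by
    rw [← hxq, dist_comm]
    exact (const hA hB x' hx' x hx).trans (Metric.infDist_le_dist_of_mem hq)
  have f1 : IsFoot B x q := ⟨hq, fun r hr => hxq ▸ Metric.infDist_le_dist_of_mem hr⟩
  have f2 : IsFoot A q x := by
    refine ⟨hx, fun r hr => ?_⟩
    rw [dist_comm q x]
    refine e1.trans ?_
    rw [← hqx']
    exact Metric.infDist_le_dist_of_mem hr
  have s1 := f1.sinh_le hB.1.convex (hB.1.isFoot_map hγ f1) (by rw [γ.isometry.dist_eq])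
  have s2 := f2.sinh_le hA.1.convex (hA.1.isFoot_map hγ f2) (by rw [γ.isometry.dist_eq])
  have hpos : 0 < dist q (γ q) := dist_pos.2 fun h => h1 (hΓ.free γ hγ q h.symm)
  have hsp : 0 < Real.sinh (dist q (γ q) / 2) := Real.sinh_pos_iff.2 (by linarith)
  rw [dist_comm q x] at s2
  have hc : Real.cosh (dist x q) = 1 := by
    refine le_antisymm ?_ (Real.one_le_cosh _)
    by_contra! hlt
    nlinarith [sinh_half_nonneg x (γ x)]
  rw [cosh_dist] at hc
  rwa [eq_of_form_eq_one hc]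

theorem isHullCandidate_univ : IsHullCandidate Γ ε univ where
  nonempty := ⟨ofSpace 0, mem_univ _⟩
  closed := isClosed_univ
  convex _ _ _ _ _ _ := mem_univ _
  invariant _ _ _ _ := mem_univ _
  thin_subset := subset_univ _

/-- Zorn's lemma. Only nonemptiness of the intersection of a chain is at issue; all members meet one
compact ball. -/
theorem exists_minimal_subset (hε : 0 < ε) {γ : HypSpace n ≃ᵢ HypSpace n}
    (hγ : γ ∈ Γ) (h1 : γ ≠ 1) {C : Set (HypSpace n)} (hC : IsHullCandidate Γ ε C) :
    ∃ A ⊆ C, Minimal (IsHullCandidate Γ ε) A := by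
  refine zorn_superset_nonempty {C | IsHullCandidate Γ ε C} ?_ C hC
  intro c hc hchain hne
  obtain ⟨R, hR⟩ := IsHullCandidate.exists_radius (Γ := Γ) hε hγ h1 (ofSpace 0)
  refine ⟨⋂₀ c, ?_, fun s hs => sInter_subset_of_mem hs⟩
  refine ⟨?_, isClosed_sInter fun s hs => (hc hs).closed, ?_, ?_, ?_⟩
  · have := hne.to_subtype
    have hK := IsCompact.nonempty_iInter_of_directed_nonempty_isCompact_isClosed
      (ι := c) (fun s => (s : Set (HypSpace n)) ∩ Metric.closedBall (ofSpace 0) R) ?_ ?_ ?_ ?_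
    · obtain ⟨x, hx⟩ := hK
      exact ⟨x, fun s hs => (mem_iInter.1 hx ⟨s, hs⟩).1⟩
    · rintro ⟨s, hs⟩ ⟨t, ht⟩
      rcases hchain.total hs ht with h | h
      · exact ⟨⟨s, hs⟩, subset_rfl, inter_subset_inter_left _ h⟩
      · exact ⟨⟨t, ht⟩, inter_subset_inter_left _ h, subset_rfl⟩
    · rintro ⟨s, hs⟩
      exact hR s (hc hs)
    · rintro ⟨s, hs⟩
      exact (isCompact_closedBall _ _).inter_left (hc hs).closed
    · rintro ⟨s, hs⟩
      exact (hc hs).closed.inter Metric.isClosed_closedBall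
  · intro x hx y hy z hz s hs
    exact (hc hs).convex x (hx s hs) y (hy s hs) z hz
  · intro γ hγ x hx s hs
    exact (hc hs).invariant γ hγ x (hx s hs)
  · exact subset_sInter fun s hs => (hc hs).thin_subset

/-- Without thin points the intersection of all candidates might a priori be empty. But every
candidate contains a minimal one, and the minimal one is unique. -/
theorem thickHull_nonempty (hΓ : IsHyperbolicManifoldGroup Γ) (hε : 0 < ε)
    {γ : HypSpace n ≃ᵢ HypSpace n} (hγ : γ ∈ Γ) (h1 : γ ≠ 1) : (thickHull Γ ε).Nonempty := by
  rcases (thinSet Γ ε).eq_empty_or_nonempty with hthin | ⟨x, hx⟩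
  · obtain ⟨A, -, hA⟩ := exists_minimal_subset hε hγ h1 (isHullCandidate_univ (Γ := Γ) (ε := ε))
    obtain ⟨x, hx⟩ := hA.1.nonempty
    refine ⟨x, mem_thickHull.2 fun C hC => ?_⟩
    obtain ⟨B, hBC, hB⟩ := exists_minimal_subset hε hγ h1 hC
    exact hBC (subset_of_minimal hΓ hγ h1 hthin hA hB hx)
  · exact ⟨x, mem_thickHull.2 fun C hC => hC.thin_subset hx⟩

theorem isHullCandidate_thickHull (hΓ : IsHyperbolicManifoldGroup Γ) (hε : 0 < ε)
    {γ : HypSpace n ≃ᵢ HypSpace n} (hγ : γ ∈ Γ) (h1 : γ ≠ 1) :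
    IsHullCandidate Γ ε (thickHull Γ ε) where
  nonempty := thickHull_nonempty hΓ hε hγ h1
  closed := isClosed_sInter fun _ hs => hs.2.1
  convex := by
    intro x hx y hy z hz
    rw [mem_thickHull] at *
    exact fun C hC => hC.convex x (hx C hC) y (hy C hC) z hz
  invariant := by
    intro γ hγ x hx
    rw [mem_thickHull] at *
    exact fun C hC => hC.invariant γ hγ x (hx C hC)
  thin_subset := subset_sInter fun _ hs => hs.2.2.2.2

end Hull

/-! ### The quotient manifold: path lifting and lengths -/

namespace HypQuotient

variable {n : ℕ} {Γ : Subgroup (HypSpace n ≃ᵢ HypSpace n)}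

theorem proj_apply {γ : HypSpace n ≃ᵢ HypSpace n} (hγ : γ ∈ Γ) (x : HypSpace n) :
    proj Γ (γ x) = proj Γ x :=
  ((proj_eq_iff Γ).2 ⟨γ, hγ, rfl⟩).symm

theorem dist_proj_le (x y : HypSpace n) : dist (proj Γ x) (proj Γ y) ≤ dist x y :=
  csInf_le ⟨0, distSet_nonneg Γ _ _⟩ ⟨x, y, rfl, rfl, rfl⟩

theorem continuous_proj : Continuous (proj Γ) :=
  (LipschitzWith.of_dist_le_mul (K := 1) fun x y => by simpa using dist_proj_le x y).continuous

theorem exists_lift_dist_lt {x : HypSpace n} {q : HypQuotient Γ} {r : ℝ}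
    (h : dist (proj Γ x) q < r) : ∃ y, proj Γ y = q ∧ dist x y < r := by
  obtain ⟨_, ⟨x', y, hx, hy, rfl⟩, h'⟩ := (csInf_lt_iff ⟨0, distSet_nonneg Γ _ _⟩
    (distSet_nonempty Γ _ _)).1 h
  obtain ⟨γ, hγ, rfl⟩ := (proj_eq_iff Γ).1 hx
  refine ⟨γ y, (proj_apply hγ y).trans hy, ?_⟩
  rwa [γ.isometry.dist_eq]

theorem isOpenMap_proj : IsOpenMap (proj Γ) := by
  intro U hU
  rw [Metric.isOpen_iff]
  rintro _ ⟨x, hx, rfl⟩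
  obtain ⟨r, hr, hball⟩ := Metric.isOpen_iff.1 hU x hx
  refine ⟨r, hr, fun q hq => ?_⟩
  rw [Metric.mem_ball, dist_comm] at hq
  obtain ⟨y, rfl, hy⟩ := exists_lift_dist_lt hq
  exact ⟨y, hball (by rwa [Metric.mem_ball, dist_comm]), rfl⟩

/-- The displacement of the nontrivial elements is bounded below on bounded sets. -/
theorem exists_le_dist (hΓ : IsHyperbolicManifoldGroup Γ) (x : HypSpace n) (B : ℝ) :
    ∃ r > 0, ∀ y ∈ Metric.closedBall x B, ∀ γ ∈ Γ, γ ≠ 1 → r ≤ dist y (γ y) := by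
  -- An element that moves x by more than 2B + 1 moves every point of the ball by more than 1.
  -- Finitely many elements remain, each with a positive minimal displacement on the compact ball.
  have hF := hΓ.discrete x (2 * B + 1)
  have h1 : ∀ γ ∈ {γ : HypSpace n ≃ᵢ HypSpace n | γ ∈ Γ ∧ dist x (γ x) ≤ 2 * B + 1},
      ∀ᶠ r in nhdsWithin (0 : ℝ) (Ioi 0),
        ∀ y ∈ Metric.closedBall x B, γ ≠ 1 → r ≤ dist y (γ y) := by
    rintro γ ⟨hγ, -⟩
    by_cases hγ1 : γ = 1
    · exact Filter.Eventually.of_forall fun r y _ h => absurd hγ1 h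
    rcases (Metric.closedBall x B).eq_empty_or_nonempty with he | hne
    · exact Filter.Eventually.of_forall fun r y hy => by simp [he] at hy
    obtain ⟨y₀, -, hy₀⟩ := (isCompact_closedBall x B).exists_isMinOn hne
      (f := fun y => dist y (γ y))
      (continuous_id.dist γ.isometry.continuous).continuousOn
    have hpos : 0 < dist y₀ (γ y₀) := dist_pos.2 fun h => hγ1 (hΓ.free γ hγ y₀ h.symm)
    filter_upwards [Ioc_mem_nhdsGT hpos] with r hr y hy _
    exact hr.2.trans (hy₀ hy)
  have h2 := ((Filter.eventually_all_finite hF).2 h1).and (Ioc_mem_nhdsGT (zero_lt_one' ℝ))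
  obtain ⟨r, hr, hr0, hr1⟩ := h2.exists
  refine ⟨r, hr0, fun y hy γ hγ hγ1 => ?_⟩
  by_cases hd : dist x (γ x) ≤ 2 * B + 1
  · exact hr γ ⟨hγ, hd⟩ y hy hγ1
  · rw [Metric.mem_closedBall] at hy
    have t1 := dist_triangle x y (γ x)
    have t2 := dist_triangle y (γ y) (γ x)
    rw [γ.isometry.dist_eq] at t2
    rw [dist_comm x y] at t1
    linarith

/-- If nontrivial elements move x by at least r, the translates of the ball of radius r/2 about x
are disjoint. -/
theorem isCoveringMap_proj (hΓ : IsHyperbolicManifoldGroup Γ) : IsCoveringMap (proj Γ) := by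
  let _ : MulAction Γ (HypSpace n) :=
    { smul := fun γ x => γ.1 x
      one_smul := fun _ => rfl
      mul_smul := fun _ _ _ => rfl }
  have hq : IsQuotientCoveringMap (proj Γ) Γ :=
    { isOpenMap_proj.isQuotientMap continuous_proj (proj_surjective Γ) with
      continuous_const_smul := fun γ => γ.1.isometry.continuous
      apply_eq_iff_mem_orbit := by
        intro x y
        rw [eq_comm, proj_eq_iff]
        exact ⟨fun ⟨γ, hγ, h⟩ => ⟨⟨γ, hγ⟩, h⟩, fun ⟨⟨γ, hγ⟩, h⟩ => ⟨γ, hγ, h⟩⟩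
      disjoint := by
        intro x
        obtain ⟨r, hr, h⟩ := exists_le_dist hΓ x 0
        refine ⟨Metric.ball x (r / 2), Metric.ball_mem_nhds _ (by linarith), ?_⟩
        rintro ⟨γ, hγ⟩ ⟨_, ⟨y, hy, rfl⟩, hy'⟩
        by_contra hne
        have h1 := h x (Metric.mem_closedBall_self le_rfl) γ hγ fun h => hne (Subtype.ext h)
        rw [Metric.mem_ball] at hy hy'
        have h2 : dist (γ y) x < r / 2 := hy'
        have t := dist_triangle x (γ y) (γ x)
        rw [γ.isometry.dist_eq] at t
        rw [dist_comm] at h2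
        linarith }
  exact hq.isCoveringMap

/-! ### Lengths and lifts of paths -/

theorem eVariationOn_congr_edist {α X Y : Type*} [LinearOrder α] [PseudoEMetricSpace X]
    [PseudoEMetricSpace Y] {f : α → X} {g : α → Y} {s : Set α}
    (h : ∀ x ∈ s, ∀ y ∈ s, edist (f x) (f y) = edist (g x) (g y)) :
    eVariationOn f s = eVariationOn g s := by
  unfold eVariationOn
  exact iSup_congr fun p => Finset.sum_congr rfl fun i _ => h _ (p.2.2.2 _) _ (p.2.2.2 _)

/-- The projection is isometric at small scales, uniformly on bounded sets. -/
theorem exists_dist_proj_eq (hΓ : IsHyperbolicManifoldGroup Γ) (x : HypSpace n) (B : ℝ) :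
    ∃ r > 0, ∀ y ∈ Metric.closedBall x B, ∀ z ∈ Metric.closedBall x B, dist y z < r →
      dist (proj Γ y) (proj Γ z) = dist y z := by
  obtain ⟨r, hr, h⟩ := exists_le_dist hΓ x B
  refine ⟨r / 2, by linarith, fun y hy z hz hd => le_antisymm (dist_proj_le y z) ?_⟩
  refine le_csInf (distSet_nonempty Γ _ _) ?_
  rintro _ ⟨y', z', hy', hz', rfl⟩
  obtain ⟨γ, hγ, rfl⟩ := (proj_eq_iff Γ).1 hy'.symm
  obtain ⟨η, hη, rfl⟩ := (proj_eq_iff Γ).1 hz'.symm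
  have e : dist (γ y) (η z) = dist y ((γ⁻¹ * η) z) := by
    rw [← γ.isometry.dist_eq y]
    congr 1
    exact (γ.apply_symm_apply (η z)).symm
  rw [e]
  by_cases h1 : γ⁻¹ * η = 1
  · rw [h1]; rfl
  · have h2 := h z hz _ (Γ.mul_mem (Γ.inv_mem hγ) hη) h1
    have t := dist_triangle z y ((γ⁻¹ * η) z)
    rw [dist_comm z y] at t
    linarith

/-- The projection preserves small distances uniformly along the compact image of c. Cut the
interval into pieces with images in small balls and add up their variations. -/
theorem eVariationOn_proj (hΓ : IsHyperbolicManifoldGroup Γ) {c : I → HypSpace n}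
    (hc : Continuous c) : eVariationOn (fun t => proj Γ (c t)) univ = eVariationOn c univ := by
  obtain ⟨B, hB⟩ := (isCompact_range hc).isBounded.subset_closedBall (c 0)
  obtain ⟨r, hr, h⟩ := exists_dist_proj_eq hΓ (c 0) B
  obtain ⟨t, t0, tm, ⟨N, tN⟩, ht⟩ := exists_monotone_Icc_subset_open_cover_unitInterval
    (c := fun s : I => c ⁻¹' Metric.ball (c s) (r / 2))
    (fun s => Metric.isOpen_ball.preimage hc)
    (fun s _ => mem_iUnion.2 ⟨s, Metric.mem_ball_self (by linarith)⟩)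
  have e : (univ : Set I) = Icc (t 0) (t N) := by
    rw [t0, tN N le_rfl]
    exact (Set.eq_univ_of_forall fun s => show s ∈ Icc (0 : I) 1 from s.2).symm
  rw [e, ← eVariationOn.sum' _ tm, ← eVariationOn.sum' _ tm]
  refine Finset.sum_congr rfl fun i _ => eVariationOn_congr_edist fun a ha b hb => ?_
  obtain ⟨s, hs⟩ := ht i
  have h1 := hs ha
  have h2 := hs hb
  rw [mem_preimage, Metric.mem_ball] at h1 h2
  rw [edist_dist, edist_dist, h _ (hB (mem_range_self _)) _ (hB (mem_range_self _))]
  linarith [dist_triangle_right (c a) (c b) (c s)]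

/-- The path `p` in `M` has a lift from `x` to `y`. -/
def LiftsTo {a b : HypQuotient Γ} (p : Path a b) (x y : HypSpace n) : Prop :=
  ∃ c : Path x y, ∀ t, proj Γ (c t) = p t

theorem exists_liftsTo (hΓ : IsHyperbolicManifoldGroup Γ) {a b : HypQuotient Γ} (p : Path a b)
    {x : HypSpace n} (hx : proj Γ x = a) : ∃ y, proj Γ y = b ∧ LiftsTo p x y := by
  obtain ⟨c, h1, h2⟩ := (isCoveringMap_proj hΓ).exists_path_lifts p.toContinuousMap x
    (by simp [hx])
  have h3 : ∀ t, proj Γ (c t) = p t := fun t => congrFun h1 t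
  exact ⟨c 1, by rw [h3, p.target], ⟨c, h2, rfl⟩, h3⟩

namespace LiftsTo

variable {a b d : HypQuotient Γ} {p : Path a b} {x y z : HypSpace n}

theorem proj_left (h : LiftsTo p x y) : proj Γ x = a := by
  obtain ⟨c, hc⟩ := h
  simpa using hc 0

theorem proj_right (h : LiftsTo p x y) : proj Γ y = b := by
  obtain ⟨c, hc⟩ := h
  simpa using hc 1

theorem cast {a' b' : HypQuotient Γ} (h : LiftsTo p x y) (ha : a' = a) (hb : b' = b) :
    LiftsTo (p.cast ha hb) x y := by
  obtain ⟨c, hc⟩ := h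
  exact ⟨c, fun t => by simp [hc]⟩

theorem refl {x : HypSpace n} {a : HypQuotient Γ} (h : proj Γ x = a) :
    LiftsTo (Path.refl a) x x :=
  ⟨Path.refl x, fun t => by simp [h]⟩

theorem symm (h : LiftsTo p x y) : LiftsTo p.symm y x := by
  obtain ⟨c, hc⟩ := h
  exact ⟨c.symm, fun t => by simp [Path.symm_apply, hc]⟩

theorem trans {q : Path b d} (h : LiftsTo p x y) (h' : LiftsTo q y z) :
    LiftsTo (p.trans q) x z := by
  obtain ⟨c, hc⟩ := h
  obtain ⟨c', hc'⟩ := h'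
  refine ⟨c.trans c', fun t => ?_⟩
  rw [Path.trans_apply, Path.trans_apply]
  split_ifs
  · exact hc _
  · exact hc' _

theorem smul (h : LiftsTo p x y) {γ : HypSpace n ≃ᵢ HypSpace n} (hγ : γ ∈ Γ) :
    LiftsTo p (γ x) (γ y) := by
  obtain ⟨c, hc⟩ := h
  exact ⟨c.map γ.isometry.continuous, fun t => by
    rw [Path.map_coe, Function.comp_apply, proj_apply hγ, hc]⟩

/-- ℍⁿ is simply connected, so the two lifts are homotopic and the homotopy projects. All homotopy
conditions of edge moves are checked by comparing endpoints of lifts in this way. -/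
theorem pathHomotopic {a' b' : HypQuotient Γ} {q : Path a' b'} (h : LiftsTo p x y)
    (h' : LiftsTo q x y) : PathHomotopic p q := by
  have ha : a = a' := h.proj_left.symm.trans h'.proj_left
  have hb : b = b' := h.proj_right.symm.trans h'.proj_right
  obtain ⟨c, hc⟩ := h
  obtain ⟨c', hc'⟩ := h'
  refine ⟨ha, hb, ?_⟩
  have hcc : c.Homotopic c' := SimplyConnectedSpace.paths_homotopic c c'
  have hm := hcc.map (⟨proj Γ, continuous_proj⟩ : C(HypSpace n, HypQuotient Γ))
  have xa : a = proj Γ x := by simpa using (hc 0).symm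
  have yb : b = proj Γ y := by simpa using (hc 1).symm
  subst xa yb ha hb
  have e1 : p = c.map continuous_proj := Path.ext (funext fun t => (hc t).symm)
  have e2 : q = c'.map continuous_proj := Path.ext (funext fun t => (hc' t).symm)
  rw [e1, e2]
  exact hm

theorem ofReal_dist_le (hΓ : IsHyperbolicManifoldGroup Γ) (h : LiftsTo p x y) :
    ENNReal.ofReal (dist x y) ≤ eVariationOn p univ := by
  obtain ⟨c, hc⟩ := h
  have e : (p : I → HypQuotient Γ) = fun t => proj Γ (c t) := funext fun t => (hc t).symm
  rw [e, eVariationOn_proj hΓ c.continuous, ← edist_dist]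
  simpa using eVariationOn.edist_le c (mem_univ 0) (mem_univ 1)

/-- A path that is no longer than the distance of the endpoints of its lift is geodesic. -/
theorem exists_between (hΓ : IsHyperbolicManifoldGroup Γ) (h : LiftsTo p x y)
    (hl : eVariationOn p univ ≤ ENNReal.ofReal (dist x y)) (t : I) :
    ∃ z, proj Γ z = p t ∧ dist x z + dist z y = dist x y := by
  obtain ⟨c, hc⟩ := h
  have e : (p : I → HypQuotient Γ) = fun t => proj Γ (c t) := funext fun t => (hc t).symm
  rw [e, eVariationOn_proj hΓ c.continuous] at hl
  refine ⟨c t, hc t, le_antisymm ?_ (dist_triangle _ _ _)⟩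
  have h1 := eVariationOn.Icc_add_Icc c (s := univ) (a := 0) (b := t) (c := 1) t.2.1 t.2.2
    (mem_univ _)
  have h2 := eVariationOn.edist_le c (s := univ ∩ Icc 0 t) (x := 0) (y := t)
    ⟨mem_univ _, le_rfl, t.2.1⟩ ⟨mem_univ _, t.2.1, le_rfl⟩
  have h3 := eVariationOn.edist_le c (s := univ ∩ Icc t 1) (x := t) (y := 1)
    ⟨mem_univ _, le_rfl, t.2.2⟩ ⟨mem_univ _, t.2.2, le_rfl⟩
  have h4 := eVariationOn.mono c (t := univ ∩ Icc 0 1) (s := univ) inter_subset_left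
  have h5 : edist x (c t) + edist (c t) y ≤ ENNReal.ofReal (dist x y) := by
    rw [c.source] at h2
    rw [c.target] at h3
    calc _ ≤ _ := add_le_add h2 h3
      _ ≤ _ := h1.le.trans (h4.trans hl)
  rw [edist_dist, edist_dist, ← ENNReal.ofReal_add dist_nonneg dist_nonneg] at h5
  exact (ENNReal.ofReal_le_ofReal_iff dist_nonneg).1 h5

end LiftsTo

/-- The projection of a geodesic segment. -/
theorem exists_geodesic {a b : HypQuotient Γ} {x y : HypSpace n} (hx : proj Γ x = a)
    (hy : proj Γ y = b) :
    ∃ p : Path a b, LiftsTo p x y ∧ eVariationOn p univ ≤ ENNReal.ofReal (dist x y) := by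
  subst hx hy
  obtain ⟨c, hc⟩ := HypSpace.exists_geodesic x y
  refine ⟨c.map continuous_proj, ⟨c, fun t => rfl⟩, ?_⟩
  refine HypSpace.eVariationOn_le_of_dist_le dist_nonneg fun s t => ?_
  rw [← hc]
  exact dist_proj_le _ _

end HypQuotient

/-! ### Edge paths -/

namespace MultiGraph

variable {V E : Type*} {G : MultiGraph V E}

/-- The oriented edge with the opposite orientation. -/
def flip (d : E × Bool) : E × Bool := (d.1, !d.2)

theorem dsrc_flip (d : E × Bool) : G.dsrc (flip d) = G.dtgt d := by
  rcases d with ⟨e, _ | _⟩ <;> rfl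

theorem dtgt_flip (d : E × Bool) : G.dtgt (flip d) = G.dsrc d := by
  rcases d with ⟨e, _ | _⟩ <;> rfl

namespace EdgePath

/-- The edge path with a single edge. -/
def single (d : E × Bool) : G.EdgePath (G.dsrc d) (G.dtgt d) := .cons d rfl rfl (.nil _)

/-- Concatenation of edge paths. -/
def append : {u v w : V} → G.EdgePath u v → G.EdgePath v w → G.EdgePath u w
  | _, _, _, .nil _, q => q
  | _, _, _, .cons d hs ht p, q => .cons d hs ht (p.append q)

theorem edges_append {u v w : V} (p : G.EdgePath u v) (q : G.EdgePath v w) :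
    (p.append q).edges = p.edges ++ q.edges := by
  induction p with
  | nil => rfl
  | cons d hs ht p ih => simp [append, edges, ih]

/-- The reversed edge path. -/
def reverse : {u v : V} → G.EdgePath u v → G.EdgePath v u
  | _, _, .nil u => .nil u
  | _, _, .cons d hs ht p =>
    p.reverse.append (.cons (flip d) ((dsrc_flip d).trans ht) ((dtgt_flip d).trans hs) (.nil _))

theorem edges_reverse {u v : V} (p : G.EdgePath u v) : p.reverse.edges = p.edges.reverse := by
  induction p with
  | nil => rfl
  | cons d hs ht p ih => simp [reverse, edges_append, edges, ih, flip]

theorem exists_suffix {u v x : V} (p : G.EdgePath u v) (hn : p.starts.Nodup) (hv : v ∉ p.starts)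
    (hx : x ∈ p.starts) :
    ∃ q : G.EdgePath x v, q.starts.Nodup ∧ v ∉ q.starts ∧ q.edges ⊆ p.edges := by
  induction p with
  | nil => simp [starts] at hx
  | @cons u u' v d hs ht p ih =>
    by_cases hxu : x = u
    · subst hxu
      exact ⟨.cons d hs ht p, hn, hv, List.Subset.refl _⟩
    · simp only [starts, List.nodup_cons, List.mem_cons, not_or] at hn hv hx
      obtain ⟨q, h1, h2, h3⟩ := ih hn.2 hv.2 (hx.resolve_left hxu)
      exact ⟨q, h1, h2, fun e he => List.mem_cons_of_mem _ (h3 he)⟩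

/-- Every edge path contains one that visits no vertex twice. -/
theorem exists_simple {u v : V} (p : G.EdgePath u v) :
    ∃ q : G.EdgePath u v, q.starts.Nodup ∧ v ∉ q.starts ∧ q.edges ⊆ p.edges := by
  induction p with
  | nil u => exact ⟨.nil u, by simp [starts], by simp [starts], List.Subset.refl _⟩
  | @cons u u' v d hs ht p ih =>
    obtain ⟨q, h1, h2, h3⟩ := ih
    by_cases huv : u = v
    · subst huv
      exact ⟨.nil u, by simp [starts], by simp [starts], by simp [edges]⟩
    by_cases hu : u ∈ q.starts
    · obtain ⟨q', h1', h2', h3'⟩ := q.exists_suffix h1 h2 hu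
      exact ⟨q', h1', h2', fun e he => List.mem_cons_of_mem _ (h3 (h3' he))⟩
    · refine ⟨.cons d hs ht q, ?_, ?_, ?_⟩
      · simp [starts, hu, h1]
      · simp [starts, Ne.symm huv, h2]
      · simp only [edges, List.cons_subset, List.mem_cons, true_or, true_and]
        exact fun e he => List.mem_cons_of_mem _ (h3 he)

theorem dsrc_mem {u v : V} (p : G.EdgePath u v) {d : E × Bool} (hd : d.1 ∈ p.edges) :
    G.dsrc d ∈ p.starts ∨ G.dsrc d = v := by
  induction p with
  | nil => simp [edges] at hd
  | @cons u u' v d' hs ht p ih =>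
    simp only [edges, List.mem_cons] at hd
    rcases hd with hd | hd
    · have : d = d' ∨ d = flip d' := by
        rcases d with ⟨e, _ | _⟩ <;> rcases d' with ⟨e', _ | _⟩ <;> simp_all [flip]
      rcases this with rfl | rfl
      · exact Or.inl (by simp [starts, hs])
      · rw [dsrc_flip, ht]
        cases p with
        | nil => exact Or.inr rfl
        | cons => exact Or.inl (by simp [starts])
    · rcases ih hd with h | h
      · exact Or.inl (by simp [starts, h])
      · exact Or.inr h

/-- If the first edge were used again, its initial vertex would be visited a second time. -/
theorem nodup_edges {u v : V} (p : G.EdgePath u v) (hn : p.starts.Nodup) (hv : v ∉ p.starts) :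
    p.edges.Nodup := by
  induction p with
  | nil => simp [edges]
  | @cons u u' v d hs ht p ih =>
    simp only [starts, List.nodup_cons, List.mem_cons, not_or] at hn hv
    simp only [edges, List.nodup_cons]
    refine ⟨fun hd => ?_, ih hn.2 hv.2⟩
    rcases p.dsrc_mem hd with h | h
    · exact hn.1 (hs ▸ h)
    · exact hv.1 (h.symm.trans hs)

/-- The product of the labels along an edge path. -/
def holonomy {A : Type*} [Group A] (lab : E → A) : {u v : V} → G.EdgePath u v → A
  | _, _, .nil _ => 1
  | _, _, .cons d _ _ p => (if d.2 then lab d.1 else (lab d.1)⁻¹) * p.holonomy lab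

theorem holonomy_append {A : Type*} [Group A] (lab : E → A) {u v w : V} (p : G.EdgePath u v)
    (q : G.EdgePath v w) : (p.append q).holonomy lab = p.holonomy lab * q.holonomy lab := by
  induction p with
  | nil => simp [append, holonomy]
  | cons d hs ht p ih => simp [append, holonomy, ih, mul_assoc]

/-- An edge path that runs through an edge once is split by this edge. -/
theorem exists_split {u v : V} (p : G.EdgePath u v) (hn : p.edges.Nodup) {e : E}
    (he : e ∈ p.edges) : ∃ (d : E × Bool) (p₁ : G.EdgePath u (G.dsrc d))
      (p₂ : G.EdgePath (G.dtgt d) v), d.1 = e ∧ p = p₁.append (.cons d rfl rfl p₂) ∧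
        e ∉ p₁.edges ∧ e ∉ p₂.edges := by
  induction p with
  | nil => simp [edges] at he
  | @cons u u' v d hs ht p ih =>
    simp only [edges, List.nodup_cons, List.mem_cons] at hn he
    by_cases hd : e = d.1
    · subst hs ht hd
      exact ⟨d, .nil _, p, rfl, rfl, by simp [edges], hn.1⟩
    · obtain ⟨d', p₁, p₂, h1, h2, h3, h4⟩ := ih hn.2 (he.resolve_left hd)
      exact ⟨d', .cons d hs ht p₁, p₂, h1, by rw [h2]; rfl, by simp [edges, hd, h3], h4⟩

end EdgePath

/-! ### Connectedness by edges of a given set -/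

variable (G) in
/-- The vertices are joined by an edge path in the set `P` of edges. -/
def JoinedIn (P : Set E) (u v : V) : Prop := ∃ p : G.EdgePath u v, ∀ e ∈ p.edges, e ∈ P

theorem joinedAvoiding_iff {e : E} {u v : V} : G.JoinedAvoiding e u v ↔ G.JoinedIn {e}ᶜ u v := by
  constructor
  · rintro ⟨p, hp⟩
    exact ⟨p, fun e' he' h => hp (h ▸ he')⟩
  · rintro ⟨p, hp⟩
    exact ⟨p, fun he => hp e he rfl⟩

namespace JoinedIn

variable {P Q : Set E} {u v w : V}

theorem refl (u : V) : G.JoinedIn P u u := ⟨.nil u, by simp [EdgePath.edges]⟩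

theorem symm (h : G.JoinedIn P u v) : G.JoinedIn P v u := by
  obtain ⟨p, hp⟩ := h
  exact ⟨p.reverse, by simpa [EdgePath.edges_reverse] using hp⟩

theorem trans (h : G.JoinedIn P u v) (h' : G.JoinedIn P v w) : G.JoinedIn P u w := by
  obtain ⟨p, hp⟩ := h
  obtain ⟨q, hq⟩ := h'
  refine ⟨p.append q, fun e he => ?_⟩
  rw [EdgePath.edges_append, List.mem_append] at he
  exact he.elim (hp e) (hq e)

theorem mono (h : G.JoinedIn P u v) (hPQ : P ⊆ Q) : G.JoinedIn Q u v := by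
  obtain ⟨p, hp⟩ := h
  exact ⟨p, fun e he => hPQ (hp e he)⟩

theorem dart {d : E × Bool} (hd : d.1 ∈ P) : G.JoinedIn P (G.dsrc d) (G.dtgt d) :=
  ⟨.single d, by simpa [EdgePath.single, EdgePath.edges] using hd⟩

end JoinedIn

theorem dsrc_eq_or (d d' : E × Bool) (h : d.1 = d'.1) :
    G.dsrc d = G.dsrc d' ∨ G.dsrc d = G.dtgt d' := by
  rcases d with ⟨e, _ | _⟩ <;> rcases d' with ⟨e', _ | _⟩ <;> simp_all [dsrc, dtgt]

/-- Both ends of an edge on an edge path in `P` are joined to its starting point. -/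
theorem EdgePath.joinedIn_of_mem {P : Set E} {u v : V} (p : G.EdgePath u v)
    (hp : ∀ e ∈ p.edges, e ∈ P) {d : E × Bool} (hd : d.1 ∈ p.edges) :
    G.JoinedIn P u (G.dsrc d) := by
  induction p with
  | nil => simp [edges] at hd
  | @cons u u' v d' hs ht p ih =>
    simp only [edges, List.mem_cons, forall_eq_or_imp] at hd hp
    have h1 : G.JoinedIn P u u' := by
      subst hs ht; exact JoinedIn.dart hp.1
    rcases hd with hd | hd
    · rcases dsrc_eq_or (G := G) d d' hd with h | h
      · rw [h, hs]; exact JoinedIn.refl _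
      · rw [h, ht]; exact h1
    · exact h1.trans (ih hp.2 hd)

/-- An edge of an edge path without repeated edges whose ends are joined avoiding this edge. -/
theorem EdgePath.IsSimpleClosed.joinedAvoiding {u : V} {p : G.EdgePath u u}
    (hp : p.IsSimpleClosed) {e : E} (he : e ∈ p.edges) :
    G.JoinedAvoiding e (G.src e) (G.tgt e) := by
  obtain ⟨d, p₁, p₂, rfl, -, h1, h2⟩ := p.exists_split hp.2.1 he
  have h : G.JoinedIn {d.1}ᶜ (G.dtgt d) (G.dsrc d) :=
    JoinedIn.trans (joinedAvoiding_iff.1 ⟨p₂, h2⟩) (joinedAvoiding_iff.1 ⟨p₁, h1⟩)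
  rw [joinedAvoiding_iff]
  rcases d with ⟨e, _ | _⟩
  · exact h
  · exact h.symm

theorem EdgePath.IsSimpleClosed.mem_coreEdges {u : V} {p : G.EdgePath u u}
    (hp : p.IsSimpleClosed) {e : E} (he : e ∈ p.edges) : e ∈ G.coreEdges :=
  fun h => h.1 (hp.joinedAvoiding he)

/-- An edge whose ends are joined by other edges lies on a simple closed curve. -/
theorem exists_isSimpleClosed {P : Set E} {d : E × Bool} (hd : d.1 ∉ P)
    (h : G.JoinedIn P (G.dtgt d) (G.dsrc d)) :
    ∃ p : G.EdgePath (G.dsrc d) (G.dsrc d), p.IsSimpleClosed ∧ ∀ e ∈ p.edges, e = d.1 ∨ e ∈ P := by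
  obtain ⟨p, hp⟩ := h
  obtain ⟨q, h1, h2, h3⟩ := p.exists_simple
  refine ⟨.cons d rfl rfl q, ⟨by simp [EdgePath.edges], ?_, ?_⟩, ?_⟩
  · simp only [EdgePath.edges, List.nodup_cons]
    exact ⟨fun h => hd (hp _ (h3 h)), q.nodup_edges h1 h2⟩
  · simp [EdgePath.starts, h1, h2]
  · simp only [EdgePath.edges, List.mem_cons, forall_eq_or_imp, true_or, true_and]
    exact fun e he => Or.inr (hp e (h3 he))

/-- A set of at least as many edges as there are vertices contains an edge whose ends are joined
by the others. -/
theorem exists_joinedIn_diff [Fintype V] [Nonempty V] (F : Finset E)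
    (hF : Fintype.card V ≤ F.card) : ∃ e ∈ F, G.JoinedIn (F \ {e}) (G.src e) (G.tgt e) := by
  classical
  by_contra! hno
  -- the boundaries of the edges, together with a vertex, are linearly independent
  let vec : Option F → V → ℝ
    | none => Pi.single (Classical.arbitrary V) 1
    | some e => Pi.single (G.tgt e) 1 - Pi.single (G.src e) 1
  have pair : ∀ (φ : V → ℝ) (c : Option F → ℝ), ∑ i, c i • vec i = 0 →
      c none * φ (Classical.arbitrary V) + ∑ e : F, c (some e) * (φ (G.tgt e) - φ (G.src e)) = 0 := by
    intro φ c h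
    have h2 : ∑ v, φ v * (∑ i, c i • vec i) v = 0 := by rw [h]; simp
    rw [Fintype.sum_option] at h2
    simp only [Pi.add_apply, Finset.sum_apply, Pi.smul_apply, smul_eq_mul, mul_add,
      Finset.sum_add_distrib, Finset.mul_sum, vec, Pi.sub_apply, Pi.single_apply] at h2
    rw [Finset.sum_comm] at h2
    rw [← h2]
    congr 1
    · simp [mul_comm]
    · refine Finset.sum_congr rfl fun e _ => ?_
      simp only [mul_sub, Finset.sum_sub_distrib]
      simp [mul_comm]
  have hind : LinearIndependent ℝ vec := by
    rw [Fintype.linearIndependent_iff]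
    intro c hc
    have h0 : c none = 0 := by simpa using pair (fun _ => 1) c hc
    rintro (_ | ⟨e, he⟩)
    · exact h0
    -- Test the relation against the indicator of the component of `G.src e` in F without e. Every
    -- other edge of F has both ends inside or both outside, so only the coefficient of e survives.
    -- Independence then puts |F| + 1 vectors into dimension |V|.
    have h1 := pair (fun v => if G.JoinedIn (F \ {e}) (G.src e) v then 1 else 0) c hc
    rw [h0, zero_mul, zero_add, Finset.sum_eq_single ⟨e, he⟩] at h1
    · simpa [hno e he, JoinedIn.refl] using h1
    · rintro ⟨e', he'⟩ - hne
      have hmem : e' ∈ (F \ {e} : Set E) := ⟨he', fun h => hne (Subtype.ext h)⟩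
      have hd : G.JoinedIn (F \ {e}) (G.src e') (G.tgt e') := JoinedIn.dart (d := (e', true)) hmem
      have : G.JoinedIn (F \ {e}) (G.src e) (G.src e') ↔
          G.JoinedIn (F \ {e}) (G.src e) (G.tgt e') :=
        ⟨fun h => h.trans hd, fun h => h.trans hd.symm⟩
      simp [this]
    · simp
  have hcard := hind.fintype_card_le_finrank
  simp at hcard
  omega

end MultiGraph

/-! ### Leaving a forest in the Stallings core -/

namespace MultiGraph

variable {V E : Type*} {G : MultiGraph V E}

/-- Each passage over e is replaced by a detour that joins its ends. -/
theorem Connected.joinedAvoiding (hG : G.Connected) {e : E}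
    (he : G.JoinedAvoiding e (G.src e) (G.tgt e)) (u v : V) : G.JoinedAvoiding e u v := by
  rw [joinedAvoiding_iff] at *
  obtain ⟨p⟩ := hG.2 u v
  induction p with
  | nil => exact JoinedIn.refl _
  | cons d hs ht p ih =>
    refine JoinedIn.trans ?_ ih
    subst hs ht
    by_cases hd : d.1 = e
    · subst hd
      rcases d with ⟨e, _ | _⟩
      · exact he.symm
      · exact he
    · exact JoinedIn.dart hd

theorem treeComponentAvoiding_iff {e : E} {u : V} : G.TreeComponentAvoiding e u ↔
    ∀ v, G.JoinedIn {e}ᶜ u v → ∀ p : G.EdgePath v v, p.IsSimpleClosed → e ∈ p.edges := by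
  simp only [TreeComponentAvoiding, joinedAvoiding_iff]
  exact ⟨fun h v hv p hp => by_contra fun he => h v hv p he hp,
    fun h v hv p he hp => he (h v hv p hp)⟩

theorem EdgePath.exists_suffix_of_mem {u v : V} (p : G.EdgePath u v) {e : E} (he : e ∈ p.edges) :
    ∃ d : E × Bool, d.1 = e ∧ ∃ q : G.EdgePath (G.dtgt d) v,
      q.edges.length < p.edges.length ∧ q.edges ⊆ p.edges := by
  induction p with
  | nil => simp [edges] at he
  | cons d hs ht p ih =>
    simp only [edges, List.mem_cons] at he
    rcases he with rfl | he
    · subst ht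
      exact ⟨d, rfl, p, by simp [edges], by simp [edges]⟩
    · obtain ⟨d', h1, q, h2, h3⟩ := ih he
      exact ⟨d', h1, q, by simp only [edges, List.length_cons]; omega,
        fun g hg => List.mem_cons_of_mem _ (h3 hg)⟩

/-- In a graph of rank at least two, one side of every edge of the core contains a simple closed
curve that avoids this edge. -/
theorem exists_isSimpleClosed_avoiding [Fintype V] [Fintype E] (hG : G.Connected)
    (hcard : Fintype.card V < Fintype.card E) {e : E} (he : e ∈ G.coreEdges) {d : E × Bool}
    (hd : d.1 = e) : ∃ (z : V) (Z : G.EdgePath z z), Z.IsSimpleClosed ∧ e ∉ Z.edges ∧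
      G.JoinedIn {e}ᶜ (G.dsrc d) z := by
  classical
  by_cases hb : G.JoinedAvoiding e (G.src e) (G.tgt e)
  · have := hG.1
    obtain ⟨e', he', hj⟩ := exists_joinedIn_diff (G := G) (Finset.univ.erase e) (by
      rw [Finset.card_erase_of_mem (Finset.mem_univ _), Finset.card_univ]; omega)
    obtain ⟨p, hp, hpe⟩ := exists_isSimpleClosed (G := G) (d := (e', true))
      (P := ((Finset.univ.erase e : Finset E) : Set E) \ {e'}) (by simp) hj.symm
    refine ⟨_, p, hp, fun h => ?_, joinedAvoiding_iff.1 (hG.joinedAvoiding hb _ _)⟩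
    rcases hpe e h with h | h
    · exact (Finset.mem_erase.1 he').1 h.symm
    · simp at h
  · have h2 : ¬ G.TreeComponentAvoiding e (G.dsrc d) := by
      intro ht
      refine he ⟨hb, ?_⟩
      subst hd
      rcases d with ⟨e, _ | _⟩
      · exact Or.inr ht
      · exact Or.inl ht
    rw [treeComponentAvoiding_iff] at h2
    push Not at h2
    obtain ⟨z, hz, Z, hZ, hZe⟩ := h2
    exact ⟨z, Z, hZ, hZe, hz⟩

/-- Let `U` be a set of edges of the core of a graph of rank at least two, and let `S` be the set
of vertices joined by `U` to a vertex of the core. If there is no simple closed curve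
in `U` at `S`, then two different edges of the core outside `U` start in `S`. -/
theorem exists_two_darts [Fintype V] [Fintype E] (hG : G.Connected)
    (hcard : Fintype.card V < Fintype.card E) {U : Set E} (hU : U ⊆ G.coreEdges) {v : V}
    (hv : ∃ d : E × Bool, d.1 ∈ G.coreEdges ∧ G.dsrc d = v)
    (hcyc : ∀ x, G.JoinedIn U v x → ∀ p : G.EdgePath x x, p.IsSimpleClosed →
      ¬ ∀ e ∈ p.edges, e ∈ U) :
    ∃ d₁ d₂ : E × Bool, d₁.1 ≠ d₂.1 ∧ (d₁.1 ∈ G.coreEdges ∧ d₁.1 ∉ U ∧ G.JoinedIn U v (G.dsrc d₁)) ∧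
      (d₂.1 ∈ G.coreEdges ∧ d₂.1 ∉ U ∧ G.JoinedIn U v (G.dsrc d₂)) := by
  by_contra hno
  -- all core edges at `S` other than `d₀` belong to `U`
  obtain ⟨d₀, hd₀, hS₀, hother⟩ : ∃ d₀ : E × Bool, d₀.1 ∈ G.coreEdges ∧
      G.JoinedIn U v (G.dsrc d₀) ∧ ∀ d : E × Bool, d.1 ∈ G.coreEdges → G.JoinedIn U v (G.dsrc d) →
        d.1 ≠ d₀.1 → d.1 ∈ U := by
    by_cases h : ∃ d : E × Bool, d.1 ∈ G.coreEdges ∧ d.1 ∉ U ∧ G.JoinedIn U v (G.dsrc d)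
    · obtain ⟨d, h1, h2, h3⟩ := h
      refine ⟨d, h1, h3, fun d' h1' h3' hne => by_contra fun h2' => ?_⟩
      exact hno ⟨d', d, hne, ⟨h1', h2', h3'⟩, h1, h2, h3⟩
    · obtain ⟨d, h1, rfl⟩ := hv
      refine ⟨d, h1, JoinedIn.refl _, fun d' h1' h3' _ => by_contra fun h2' => ?_⟩
      exact h ⟨d', h1', h2', h3'⟩
  set e := d₀.1 with he
  obtain ⟨z, Z, hZ, hZe, hz⟩ := exists_isSimpleClosed_avoiding hG hcard hd₀ he.symm
  obtain ⟨P, hP⟩ := hz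
  -- a curve of core edges that avoids `e` stays in `U`
  have stay : ∀ {a b : V} (p : G.EdgePath a b), G.JoinedIn U v a →
      (∀ g ∈ p.edges, g ∈ G.coreEdges ∧ g ≠ e) → ∀ g ∈ p.edges, g ∈ U := by
    intro a b p
    induction p with
    | nil => simp [EdgePath.edges]
    | cons d hs ht p ih =>
      intro ha h
      subst hs ht
      simp only [EdgePath.edges, List.mem_cons, forall_eq_or_imp] at h ⊢
      have hd := hother d h.1.1 ha h.1.2
      exact ⟨hd, ih (ha.trans (JoinedIn.dart hd)) h.2⟩
  -- Follow a path from S to Z that avoids e. As long as it runs in the core it stays in S, and on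
  -- arrival Z itself would lie in U, against `hcyc`. Strong induction is used because a path that
  -- recrosses a non-core edge is first shortened.
  have main : ∀ (m : ℕ) (a : V) (p : G.EdgePath a z), p.edges.length ≤ m → G.JoinedIn U v a →
      (∀ g ∈ p.edges, g ∈ ({e}ᶜ : Set E)) → False := by
    intro m
    induction m using Nat.strong_induction_on with
    | _ m ihm =>
    intro a p hm ha hp
    cases p with
    | nil =>
      exact hcyc z ha Z hZ (stay Z ha fun g hg => ⟨hZ.mem_coreEdges hg, fun h => hZe (h ▸ hg)⟩)
    | cons d hs ht p =>
      subst hs ht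
      simp only [EdgePath.edges, List.mem_cons, forall_eq_or_imp, List.length_cons] at hp hm
      have hde : d.1 ≠ e := hp.1
      by_cases hcore : d.1 ∈ G.coreEdges
      · exact ihm (m - 1) (by omega) _ p (by omega)
          (ha.trans (JoinedIn.dart (hother d hcore ha hde))) hp.2
      have hcore' := not_not.1 hcore
      have hbridge : ∀ {x : V} (W : G.EdgePath x x), W.IsSimpleClosed → d.1 ∉ W.edges :=
        fun W hW h => hcore'.1 (hW.joinedAvoiding h)
      by_cases hdp : d.1 ∈ p.edges
      · obtain ⟨d', hd', q, hq, hqp⟩ := p.exists_suffix_of_mem hdp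
        have hqe : ∀ g ∈ q.edges, g ∈ ({e}ᶜ : Set E) := fun g hg => hp.2 g (hqp hg)
        have h := dsrc_eq_or (G := G) (flip d') d hd'
        rw [dsrc_flip] at h
        generalize G.dtgt d' = x at q h
        rcases h with rfl | rfl
        · exact ihm q.edges.length (by omega) _ q le_rfl ha hqe
        · exact ihm (q.edges.length + 1) (by omega) _ (.cons d rfl rfl q) le_rfl ha
            (by simpa [EdgePath.edges] using ⟨hde, hqe⟩)
      -- the far side of `d` contains `Z`, so the near side is a tree
      have htree : G.TreeComponentAvoiding d.1 (G.dsrc d) := by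
        have h1 : ¬ G.TreeComponentAvoiding d.1 (G.dtgt d) := by
          rw [treeComponentAvoiding_iff]
          intro h
          exact hbridge Z hZ (h z (joinedAvoiding_iff.1 ⟨p, hdp⟩) Z hZ)
        rcases d with ⟨g, _ | _⟩
        · exact hcore'.2.resolve_left h1
        · exact hcore'.2.resolve_right h1
      have hnoW : ∀ x, G.JoinedIn {d.1}ᶜ (G.dsrc d) x → ∀ W : G.EdgePath x x,
          ¬ W.IsSimpleClosed := fun x hx W hW =>
        hbridge W hW (treeComponentAvoiding_iff.1 htree x hx W hW)
      have hUd : U ⊆ {d.1}ᶜ := fun g hg h => hcore (h ▸ hU hg)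
      have h0 : G.JoinedIn {d.1}ᶜ (G.dsrc d) (G.dsrc d₀) := (ha.symm.trans hS₀).mono hUd
      have h0' : G.JoinedIn {d.1}ᶜ (G.dsrc d) (G.dtgt d₀) :=
        h0.trans (JoinedIn.dart (Ne.symm hde))
      by_cases hb : G.JoinedAvoiding e (G.src e) (G.tgt e)
      · have hb' := joinedAvoiding_iff.1 (hG.joinedAvoiding hb (G.dtgt d₀) (G.dsrc d₀))
        obtain ⟨W, hW, -⟩ := exists_isSimpleClosed (d := d₀) (P := {e}ᶜ) (by simp [he]) hb'
        exact hnoW _ h0 W hW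
      -- an end of `e` on the other side of `e`
      obtain ⟨d', hd', hj, hnj⟩ : ∃ d' : E × Bool, d'.1 = e ∧
          G.JoinedIn {d.1}ᶜ (G.dsrc d) (G.dsrc d') ∧
          ¬ G.JoinedIn {e}ᶜ (G.dsrc d') (G.dsrc d) := by
        by_cases h : G.JoinedIn {e}ᶜ (G.dsrc d₀) (G.dsrc d)
        · refine ⟨flip d₀, rfl, by rwa [dsrc_flip], fun h' => hb ?_⟩
          rw [dsrc_flip] at h'
          rw [joinedAvoiding_iff]
          have h'' := h.trans h'.symm
          have : d₀ = (e, d₀.2) := rfl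
          rw [this] at h''
          generalize d₀.2 = b at h''
          cases b
          · exact h''.symm
          · exact h''
        · exact ⟨d₀, rfl, h0, h⟩
      obtain ⟨w, W, hW, -, R, hR⟩ := exists_isSimpleClosed_avoiding hG hcard hd₀ hd'
      -- The side of e away from d lies in the tree side of d, yet it contains the closed curve W.
      -- The path R to W cannot use d, since it would then join the two sides of e while avoiding e.
      refine hnoW w (hj.trans ⟨R, fun g hg hgd => hnj ?_⟩) W hW
      have hgd' : g = d.1 := hgd
      exact R.joinedIn_of_mem hR (hgd' ▸ hg)
  exact main _ _ P le_rfl hS₀ hP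

end MultiGraph

/-! ### Lifted carrier graphs -/

section Lifts

open HypQuotient MultiGraph

variable {n : ℕ} {Γ : Subgroup (HypSpace n ≃ᵢ HypSpace n)} {V E : Type*} {G : MultiGraph V E}

theorem HypQuotient.LiftsTo.subpath {a b : HypQuotient Γ} {p : Path a b} {x y : HypSpace n}
    {c : Path x y} (hc : ∀ t, proj Γ (c t) = p t) (s t : I) :
    LiftsTo (p.subpath s t) (c s) (c t) :=
  ⟨c.subpath s t, fun _ => hc _⟩

/-- Lifts of the vertices of a graph in `M`, and for each edge the element of `Γ` that takes the
lift of its terminal vertex to the end of the lift of the edge that starts at the lift of its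
initial vertex. -/
structure GraphLift (f : GraphMap G (HypQuotient Γ)) where
  /-- the lifts of the vertices -/
  pos : V → HypSpace n
  /-- the labels of the edges -/
  lab : E → HypSpace n ≃ᵢ HypSpace n
  lab_mem : ∀ e, lab e ∈ Γ
  proj_pos : ∀ v, proj Γ (pos v) = f.vert v
  lifts : ∀ e, LiftsTo (f.edge e) (pos (G.src e)) (lab e (pos (G.tgt e)))

namespace GraphLift

variable {f : GraphMap G (HypQuotient Γ)}

theorem nonempty (hΓ : IsHyperbolicManifoldGroup Γ) (f : GraphMap G (HypQuotient Γ)) :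
    Nonempty (GraphLift f) := by
  choose pos hpos using fun v => proj_surjective Γ (f.vert v)
  choose y hy hl using fun e => exists_liftsTo hΓ (f.edge e) (hpos (G.src e))
  choose lab hlab hlab' using fun e => (proj_eq_iff Γ).1 ((hpos (G.tgt e)).trans (hy e).symm)
  exact ⟨⟨pos, lab, hlab, hpos, fun e => by rw [hlab']; exact hl e⟩⟩

variable (L : GraphLift f)

/-- The label of an oriented edge. -/
noncomputable def dlab (d : E × Bool) : HypSpace n ≃ᵢ HypSpace n :=
  if d.2 then L.lab d.1 else (L.lab d.1)⁻¹

theorem dlab_mem (d : E × Bool) : L.dlab d ∈ Γ := by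
  unfold dlab
  split_ifs
  · exact L.lab_mem _
  · exact Γ.inv_mem (L.lab_mem _)

/-- The length of the geodesic representative of an edge. -/
noncomputable def len (e : E) : ℝ := dist (L.pos (G.src e)) (L.lab e (L.pos (G.tgt e)))

theorem len_nonneg (e : E) : 0 ≤ L.len e := dist_nonneg

theorem dist_dart (d : E × Bool) :
    dist (L.pos (G.dsrc d)) (L.dlab d (L.pos (G.dtgt d))) = L.len d.1 := by
  rcases d with ⟨e, _ | _⟩
  · change dist (L.pos (G.tgt e)) ((L.lab e).symm (L.pos (G.src e))) = _
    rw [← (L.lab e).isometry.dist_eq, (L.lab e).apply_symm_apply, dist_comm]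
    rfl
  · rfl

theorem lifts_dart (d : E × Bool) :
    LiftsTo (f.dart d) (L.pos (G.dsrc d)) (L.dlab d (L.pos (G.dtgt d))) := by
  rcases d with ⟨e, _ | _⟩
  · have h := (L.lifts e).symm.smul (Γ.inv_mem (L.lab_mem e))
    have e1 : (L.lab e)⁻¹ (L.lab e (L.pos (G.tgt e))) = L.pos (G.tgt e) :=
      (L.lab e).symm_apply_apply _
    rw [e1] at h
    exact h
  · exact L.lifts e

/-- The product of the labels along an edge path. -/
noncomputable def hol {u v : V} (p : G.EdgePath u v) : HypSpace n ≃ᵢ HypSpace n :=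
  p.holonomy L.lab

theorem hol_cons {u v w : V} (d : E × Bool) (hs : G.dsrc d = u) (ht : G.dtgt d = v)
    (p : G.EdgePath v w) : L.hol (.cons d hs ht p) = L.dlab d * L.hol p := rfl

theorem hol_append {u v w : V} (p : G.EdgePath u v) (q : G.EdgePath v w) :
    L.hol (p.append q) = L.hol p * L.hol q := p.holonomy_append _ q

theorem hol_mem {u v : V} (p : G.EdgePath u v) : L.hol p ∈ Γ := by
  induction p with
  | nil => exact Γ.one_mem
  | cons d hs ht p ih => exact Γ.mul_mem (L.dlab_mem d) ih

theorem lifts_pathMap {u v : V} (p : G.EdgePath u v) :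
    LiftsTo (f.pathMap p) (L.pos u) (L.hol p (L.pos v)) := by
  induction p with
  | nil u => exact LiftsTo.refl (L.proj_pos u)
  | cons d hs ht p ih =>
    subst hs ht
    exact ((L.lifts_dart d).cast _ _).trans (ih.smul (L.dlab_mem d))

theorem dist_hol_le {u v : V} (p : G.EdgePath u v) {l : ℝ} (h : ∀ e ∈ p.edges, L.len e ≤ l) :
    dist (L.pos u) (L.hol p (L.pos v)) ≤ p.edges.length * l := by
  induction p with
  | nil u =>
    have : L.hol (.nil u : G.EdgePath u u) (L.pos u) = L.pos u := rfl
    rw [this]; simp [EdgePath.edges]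
  | @cons u v w d hs ht p ih =>
    subst hs ht
    simp only [EdgePath.edges, List.mem_cons, forall_eq_or_imp, List.length_cons] at h ⊢
    have e : L.hol (.cons d rfl rfl p) (L.pos w) = L.dlab d (L.hol p (L.pos w)) := rfl
    rw [e]
    have t := dist_triangle (L.pos (G.dsrc d)) (L.dlab d (L.pos (G.dtgt d)))
      (L.dlab d (L.hol p (L.pos w)))
    rw [L.dist_dart, (L.dlab d).isometry.dist_eq] at t
    have := ih h.2
    push_cast
    linarith [h.1]

/-! ### Inequalities forced by minimal length -/

theorem sum_len_le_length [Fintype E] (hΓ : IsHyperbolicManifoldGroup Γ) :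
    ∑ e, ENNReal.ofReal (L.len e) ≤ f.length :=
  Finset.sum_le_sum fun e _ => (L.lifts e).ofReal_dist_le hΓ

open Classical in
-- The competitor sends every edge, not only the moved one, to the geodesic with the prescribed ends
-- of its lift; the homotopy that follows an edge move permits this.
theorem length_le_of_vertex [Fintype E] (hmin : f.MinimalRelVertices) (d : E × Bool) {w : V}
    (α : G.EdgePath (G.dtgt d) w) (hα : d.1 ∉ α.edges) :
    f.length ≤ ∑ e, ENNReal.ofReal (if e = d.1 then
      dist (L.pos (G.dsrc d)) (L.dlab d (L.hol α (L.pos w))) else L.len e) := by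
  have key : ∀ e, ∃ p : Path (f.vert ((G.reattach d w).src e)) (f.vert ((G.reattach d w).tgt e)),
      (e = d.1 → LiftsTo p (L.pos (G.dsrc d)) (L.dlab d (L.hol α (L.pos w)))) ∧
      (e ≠ d.1 → LiftsTo p (L.pos (G.src e)) (L.lab e (L.pos (G.tgt e)))) ∧
      eVariationOn p univ ≤ ENNReal.ofReal (if e = d.1 then
        dist (L.pos (G.dsrc d)) (L.dlab d (L.hol α (L.pos w))) else L.len e) := by
    intro e
    by_cases he : e = d.1
    · obtain ⟨p, h1, h2⟩ := exists_geodesic (Γ := Γ) (x := L.pos (G.dsrc d))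
        (y := L.dlab d (L.hol α (L.pos w))) (a := f.vert ((G.reattach d w).src e))
        (b := f.vert ((G.reattach d w).tgt e)) (by simp [reattach, he, L.proj_pos])
        (by simp [reattach, he, L.proj_pos, proj_apply (L.dlab_mem d), proj_apply (L.hol_mem α)])
      exact ⟨p, fun _ => h1, fun h => absurd he h, by rwa [if_pos he]⟩
    · obtain ⟨p, h1, h2⟩ := exists_geodesic (Γ := Γ) (x := L.pos (G.src e))
        (y := L.lab e (L.pos (G.tgt e))) (a := f.vert ((G.reattach d w).src e))
        (b := f.vert ((G.reattach d w).tgt e)) (by simp [reattach, he, L.proj_pos])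
        (by simp [reattach, he, L.proj_pos, proj_apply (L.lab_mem e)])
      exact ⟨p, fun h => absurd h he, fun _ => h1, by rwa [if_neg he]⟩
  choose p hp1 hp2 hp3 using key
  let g : GraphMap (G.reattach d w) (HypQuotient Γ) := ⟨f.vert, p⟩
  have hg : f.IsVertexMove d α g :=
    { avoids := hα
      vert_eq := fun _ => rfl
      moved := (hp1 d.1 rfl).pathHomotopic
        ((L.lifts_dart d).trans ((L.lifts_pathMap α).smul (L.dlab_mem d)))
      other := fun e he => (hp2 e he).pathHomotopic (L.lifts e) }
  exact (hmin.vertex d w α g hg).trans (Finset.sum_le_sum fun e _ => hp3 e)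

/-- No edge move to a vertex shortens an edge. -/
theorem len_le_of_vertex [Fintype E] (hΓ : IsHyperbolicManifoldGroup Γ)
    (hmin : f.MinimalRelVertices) (d : E × Bool) {w : V}
    (α : G.EdgePath (G.dtgt d) w) (hα : d.1 ∉ α.edges) :
    L.len d.1 ≤ dist (L.pos (G.dsrc d)) (L.dlab d (L.hol α (L.pos w))) := by
  classical
  have h := (L.sum_len_le_length hΓ).trans (L.length_le_of_vertex hmin d α hα)
  rw [← ENNReal.ofReal_sum_of_nonneg (fun e _ => L.len_nonneg e),
    ← ENNReal.ofReal_sum_of_nonneg, ENNReal.ofReal_le_ofReal_iff] at h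
  · rw [← Finset.add_sum_erase _ _ (Finset.mem_univ d.1),
      ← Finset.add_sum_erase (a := d.1) (f := fun e => ite _ _ _) _ (Finset.mem_univ d.1),
      if_pos rfl] at h
    have : ∑ e ∈ Finset.univ.erase d.1, (if e = d.1 then
        dist (L.pos (G.dsrc d)) (L.dlab d (L.hol α (L.pos w))) else L.len e) =
        ∑ e ∈ Finset.univ.erase d.1, L.len e :=
      Finset.sum_congr rfl fun e he => if_neg (Finset.ne_of_mem_erase he)
    rw [this] at h
    linarith
  · exact Finset.sum_nonneg fun e _ => by split_ifs; exacts [dist_nonneg, L.len_nonneg e]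
  · intro e _
    split_ifs
    exacts [dist_nonneg, L.len_nonneg e]

/-- The edges of a graph of minimal length rel vertices are geodesic. -/
theorem eVariationOn_edge_le [Fintype E] (hΓ : IsHyperbolicManifoldGroup Γ)
    (hmin : f.MinimalRelVertices) (e : E) :
    eVariationOn (f.edge e) univ ≤ ENNReal.ofReal (L.len e) := by
  classical
  -- The move along a constant path leaves the graph as it is and only straightens the edges.
  have h := L.length_le_of_vertex hmin (e, true) (.nil _) (by simp [EdgePath.edges])
  have h' : f.length ≤ ∑ e, ENNReal.ofReal (L.len e) := by
    refine h.trans_eq (Finset.sum_congr rfl fun e' _ => ?_)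
    split_ifs with he
    · rw [he]
      congr 1
    · rfl
  rw [GraphMap.length, ← Finset.add_sum_erase _ _ (Finset.mem_univ e),
    ← Finset.add_sum_erase _ (fun e => ENNReal.ofReal (L.len e)) (Finset.mem_univ e)] at h'
  have h2 : ∑ e' ∈ Finset.univ.erase e, ENNReal.ofReal (L.len e') ≤
      ∑ e' ∈ Finset.univ.erase e, eVariationOn (f.edge e') univ :=
    Finset.sum_le_sum fun e' _ => (L.lifts e').ofReal_dist_le hΓ
  have h3 : ∑ e' ∈ Finset.univ.erase e, ENNReal.ofReal (L.len e') ≠ ⊤ :=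
    ENNReal.sum_ne_top.2 fun _ _ => ENNReal.ofReal_ne_top
  exact ENNReal.le_of_add_le_add_right h3 ((add_le_add le_rfl h2).trans h')

open Classical in
-- Here z is arbitrary: the new vertex is free to move, so it may be sent to `proj Γ z`, with
-- geodesics for all edges and for both halves of h.
theorem length_le_of_interior [Fintype E] (hmin : f.MinimalRelVertices) (d : E × Bool) {h : E}
    (hne : h ≠ d.1) (α : G.EdgePath (G.dtgt d) (G.src h)) (hα : d.1 ∉ α.edges) (z : HypSpace n) :
    f.length ≤ ENNReal.ofReal (dist z (L.lab h (L.pos (G.tgt h)))) +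
      ∑ e, ENNReal.ofReal (if e = d.1 then dist (L.pos (G.dsrc d)) (L.dlab d (L.hol α z)) else
        if e = h then dist (L.pos (G.src h)) z else L.len e) := by
  let vert : Option V → HypQuotient Γ := fun v => v.elim (proj Γ z) f.vert
  have vert_some : ∀ v, vert (some v) = f.vert v := fun _ => rfl
  have vert_none : vert none = proj Γ z := rfl
  have key : ∀ e, ∃ p : Path (vert ((G.reattachMid d h).src (some e)))
        (vert ((G.reattachMid d h).tgt (some e))),
      (e = d.1 → LiftsTo p (L.pos (G.dsrc d)) (L.dlab d (L.hol α z))) ∧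
      (e = h → LiftsTo p (L.pos (G.src h)) z) ∧
      (e ≠ d.1 → e ≠ h → LiftsTo p (L.pos (G.src e)) (L.lab e (L.pos (G.tgt e)))) ∧
      eVariationOn p univ ≤ ENNReal.ofReal (if e = d.1 then
        dist (L.pos (G.dsrc d)) (L.dlab d (L.hol α z)) else
        if e = h then dist (L.pos (G.src h)) z else L.len e) := by
    intro e
    by_cases he : e = d.1
    · obtain ⟨p, h1, h2⟩ := exists_geodesic (Γ := Γ) (x := L.pos (G.dsrc d))
        (y := L.dlab d (L.hol α z)) (a := vert ((G.reattachMid d h).src (some e)))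
        (b := vert ((G.reattachMid d h).tgt (some e)))
        (by simp [reattachMid, he, L.proj_pos, vert_some])
        (by simp [reattachMid, he, vert_none, proj_apply (L.dlab_mem d), proj_apply (L.hol_mem α)])
      exact ⟨p, fun _ => h1, fun h' => absurd (h'.symm.trans he) hne, fun h' => absurd he h',
        by rwa [if_pos he]⟩
    by_cases heh : e = h
    · obtain ⟨p, h1, h2⟩ := exists_geodesic (Γ := Γ) (x := L.pos (G.src h))
        (y := z) (a := vert ((G.reattachMid d h).src (some e)))
        (b := vert ((G.reattachMid d h).tgt (some e)))
        (by simp [reattachMid, heh, hne, L.proj_pos, vert_some])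
        (by simp [reattachMid, heh, vert_none])
      exact ⟨p, fun h' => absurd h' he, fun _ => h1, fun _ h' => absurd heh h',
        by rwa [if_neg he, if_pos heh]⟩
    · obtain ⟨p, h1, h2⟩ := exists_geodesic (Γ := Γ) (x := L.pos (G.src e))
        (y := L.lab e (L.pos (G.tgt e))) (a := vert ((G.reattachMid d h).src (some e)))
        (b := vert ((G.reattachMid d h).tgt (some e)))
        (by simp [reattachMid, he, L.proj_pos, vert_some])
        (by simp [reattachMid, he, heh, vert_some, L.proj_pos, proj_apply (L.lab_mem e)])
      exact ⟨p, fun h' => absurd h' he, fun h' => absurd h' heh, fun _ _ => h1,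
        by rwa [if_neg he, if_neg heh]⟩
  choose p hp1 hp2 hp3 hp4 using key
  obtain ⟨q, hq1, hq2⟩ := exists_geodesic (Γ := Γ) (x := z) (y := L.lab h (L.pos (G.tgt h)))
    (a := vert ((G.reattachMid d h).src none)) (b := vert ((G.reattachMid d h).tgt none)) rfl
    (by simp [reattachMid, vert_some, L.proj_pos, proj_apply (L.lab_mem h)])
  let g : GraphMap (G.reattachMid d h) (HypQuotient Γ) :=
    ⟨vert, fun e => match e with
      | none => q
      | some e => p e⟩
  -- Any interior parameter would do, as the trace δ carries the new vertex from there to its final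
  -- place.
  let t : I := ⟨1 / 2, by norm_num, by norm_num⟩
  obtain ⟨c, hc⟩ := L.lifts h
  obtain ⟨δ, hδ, -⟩ := exists_geodesic (Γ := Γ) (x := c t) (y := z) (a := f.edge h t)
    (b := g.vert none) (hc t) rfl
  have hhead : LiftsTo (f.headSegment h t) (L.pos (G.src h)) (c t) := by
    have := (LiftsTo.subpath hc 0 t).cast (f.edge h).source.symm rfl
    rwa [c.source] at this
  have htail : LiftsTo (f.tailSegment h t) (c t) (L.lab h (L.pos (G.tgt h))) := by
    have := (LiftsTo.subpath hc t 1).cast rfl (f.edge h).target.symm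
    rwa [c.target] at this
  have hg : f.IsInteriorMove d h α t g :=
    { ne := hne
      interior := ⟨by rw [← Subtype.coe_lt_coe]; norm_num [t],
        by rw [← Subtype.coe_lt_coe]; norm_num [t]⟩
      avoids := hα
      vert_eq := fun _ => rfl
      moved := ⟨δ, (hp2 h rfl).pathHomotopic (hhead.trans hδ),
        hq1.pathHomotopic (hδ.symm.trans htail),
        (hp1 d.1 rfl).pathHomotopic
          (((L.lifts_dart d).trans ((L.lifts_pathMap α).smul (L.dlab_mem d))).trans
            (((hhead.trans hδ).smul (L.hol_mem α)).smul (L.dlab_mem d)))⟩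
      other := fun e he heh => (hp3 e he heh).pathHomotopic (L.lifts e) }
  refine (hmin.interior d h α t g hg).trans ?_
  rw [GraphMap.length, Fintype.sum_option]
  exact add_le_add hq2 (Finset.sum_le_sum fun e _ => hp4 e)

/-- No edge move to an interior point of another edge shortens an edge. -/
theorem len_le_of_interior [Fintype E] (hΓ : IsHyperbolicManifoldGroup Γ)
    (hmin : f.MinimalRelVertices) (d : E × Bool) {h : E} (hne : h ≠ d.1)
    (α : G.EdgePath (G.dtgt d) (G.src h)) (hα : d.1 ∉ α.edges) {z : HypSpace n}
    (hz : dist (L.pos (G.src h)) z + dist z (L.lab h (L.pos (G.tgt h))) = L.len h) :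
    L.len d.1 ≤ dist (L.pos (G.dsrc d)) (L.dlab d (L.hol α z)) := by
  classical
  have hl := (L.sum_len_le_length hΓ).trans (L.length_le_of_interior hmin d hne α hα z)
  set F : E → ℝ := fun e => if e = d.1 then dist (L.pos (G.dsrc d)) (L.dlab d (L.hol α z)) else
        if e = h then dist (L.pos (G.src h)) z else L.len e with hF
  have hF0 : ∀ e, 0 ≤ F e := fun e => by
    simp only [hF]; split_ifs; exacts [dist_nonneg, dist_nonneg, L.len_nonneg e]
  change _ ≤ _ + ∑ e, ENNReal.ofReal (F e) at hl
  rw [← ENNReal.ofReal_sum_of_nonneg (fun e _ => L.len_nonneg e),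
    ← ENNReal.ofReal_sum_of_nonneg (fun e _ => hF0 e), ← ENNReal.ofReal_add dist_nonneg
      (Finset.sum_nonneg fun e _ => hF0 e), ENNReal.ofReal_le_ofReal_iff
      (add_nonneg dist_nonneg (Finset.sum_nonneg fun e _ => hF0 e))] at hl
  have hmem : h ∈ Finset.univ.erase d.1 := Finset.mem_erase.2 ⟨hne, Finset.mem_univ _⟩
  rw [← Finset.add_sum_erase _ _ (Finset.mem_univ d.1), ← Finset.add_sum_erase _ L.len hmem,
    ← Finset.add_sum_erase _ F (Finset.mem_univ d.1), ← Finset.add_sum_erase _ F hmem] at hl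
  have h1 : F d.1 = dist (L.pos (G.dsrc d)) (L.dlab d (L.hol α z)) := if_pos rfl
  have h2 : F h = dist (L.pos (G.src h)) z := by simp [hF, hne]
  have h3 : ∑ e ∈ (Finset.univ.erase d.1).erase h, F e =
      ∑ e ∈ (Finset.univ.erase d.1).erase h, L.len e :=
    Finset.sum_congr rfl fun e he => by
      rw [Finset.mem_erase, Finset.mem_erase] at he
      simp [hF, he.1, he.2.1]
  rw [h1, h2, h3] at hl
  linarith

/-- No edge move to an interior point of another oriented edge shortens an edge. -/
theorem len_le_of_dart [Fintype E] (hΓ : IsHyperbolicManifoldGroup Γ)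
    (hmin : f.MinimalRelVertices) (d d' : E × Bool) (hne : d'.1 ≠ d.1)
    (α : G.EdgePath (G.dtgt d) (G.dsrc d')) (hα : d.1 ∉ α.edges) {z : HypSpace n}
    (hz : dist (L.pos (G.dsrc d')) z + dist z (L.dlab d' (L.pos (G.dtgt d'))) = L.len d'.1) :
    L.len d.1 ≤ dist (L.pos (G.dsrc d)) (L.dlab d (L.hol α z)) := by
  rcases d' with ⟨h, _ | _⟩
  · have hα' : d.1 ∉ (α.append (EdgePath.single (h, false))).edges := by
      rw [EdgePath.edges_append, List.mem_append, not_or]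
      exact ⟨hα, by simpa [EdgePath.single, EdgePath.edges] using hne.symm⟩
    have e1 : L.dlab (h, false) = (L.lab h)⁻¹ := rfl
    have e2 : ∀ x, L.lab h ((L.lab h)⁻¹ x) = x := (L.lab h).apply_symm_apply
    have e3 : ∀ x, (L.lab h)⁻¹ (L.lab h x) = x := (L.lab h).symm_apply_apply
    have e5 : dist (L.pos (G.src h)) (L.lab h z) = dist z ((L.lab h)⁻¹ (L.pos (G.src h))) := by
      rw [← (L.lab h).isometry.dist_eq z, e2, dist_comm]
    have e6 : dist (L.lab h z) (L.lab h (L.pos (G.tgt h))) = dist (L.pos (G.tgt h)) z := by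
      rw [(L.lab h).isometry.dist_eq, dist_comm]
    have key := L.len_le_of_interior hΓ hmin d hne _ hα' (z := L.lab h z)
      (by rw [e5, e6, add_comm]; exact hz)
    have e4 : L.hol (α.append (EdgePath.single (h, false))) (L.lab h z) = L.hol α z := by
      rw [L.hol_append]
      change L.hol α ((L.lab h)⁻¹ (L.lab h z)) = _
      rw [e3]
    exact e4 ▸ key
  · exact L.len_le_of_interior hΓ hmin d hne α hα hz

/-- In a reduced graph of minimal length, simple closed curves are not null-homotopic. -/
theorem hol_ne_one [Fintype E] (hΓ : IsHyperbolicManifoldGroup Γ)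
    (hmin : f.MinimalRelVertices) (hred : f.IsReduced) {v : V} {p : G.EdgePath v v}
    (hp : p.IsSimpleClosed) : L.hol p ≠ 1 := by
  intro h1
  -- Drag an end of the edge around the rest of the curve. The new edge is a loop with holonomy
  -- conjugate to that of p, hence trivial, and can be contracted to a point; by minimality the old
  -- edge is no longer than that.
  have hlen : ∀ e ∈ p.edges, L.len e ≤ 0 := by
    intro e he
    obtain ⟨d, p₁, p₂, rfl, hpe, h3, h4⟩ := p.exists_split hp.2.1 he
    have hα : d.1 ∉ (p₂.append p₁).edges := by
      rw [EdgePath.edges_append, List.mem_append, not_or]; exact ⟨h4, h3⟩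
    refine (L.len_le_of_vertex hΓ hmin d (p₂.append p₁) hα).trans_eq ?_
    have h5 : L.dlab d * L.hol (p₂.append p₁) = 1 := by
      rw [hpe, L.hol_append, L.hol_cons] at h1
      rw [L.hol_append, ← mul_assoc]
      exact mul_eq_one_comm.1 h1
    change dist _ ((L.dlab d * L.hol (p₂.append p₁)) (L.pos (G.dsrc d))) = 0
    rw [h5]
    exact dist_self _
  have hconst : ∀ e ∈ p.edges, ∀ t, f.edge e t = f.vert (G.src e) := by
    intro e he t
    obtain ⟨z, hz, hz'⟩ := (L.lifts e).exists_between hΓ (L.eVariationOn_edge_le hΓ hmin e) t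
    have : dist (L.pos (G.src e)) z = 0 := by
      have h2 : dist (L.pos (G.src e)) (L.lab e (L.pos (G.tgt e))) ≤ 0 := hlen e he
      linarith [dist_nonneg (x := L.pos (G.src e)) (y := z),
        dist_nonneg (x := z) (y := L.lab e (L.pos (G.tgt e)))]
    rw [← hz, ← dist_eq_zero.1 this, L.proj_pos]
  refine hred v p hp ⟨f.vert v, fun e he t => ?_⟩
  rw [hconst e he]
  have all : ∀ {u w : V} (q : G.EdgePath u w), (∀ e ∈ q.edges, ∀ t, f.edge e t = f.vert (G.src e)) →
      ∀ e ∈ q.edges, f.vert (G.src e) = f.vert u := by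
    intro u w q
    induction q with
    | nil => simp [EdgePath.edges]
    | cons d hs ht q ih =>
      intro h
      subst hs ht
      simp only [EdgePath.edges, List.mem_cons, forall_eq_or_imp] at h ⊢
      have h1 := h.1 1
      rw [(f.edge d.1).target] at h1
      have h2 : f.vert (G.src d.1) = f.vert (G.dsrc d) := by
        rcases d with ⟨e, _ | _⟩
        · exact h1.symm
        · rfl
      have h3 : f.vert (G.dtgt d) = f.vert (G.dsrc d) := by
        rcases d with ⟨e, _ | _⟩
        · exact h1.symm
        · exact h1
      exact ⟨h2, fun e he => (ih h.2 e he).trans h3⟩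
  exact all p hconst e he

end GraphLift

end Lifts

/-! ### Minimal length graphs orbit the convex core -/

open HypQuotient MultiGraph HypSpace

/-- The scales at which the edge lengths of a graph with `k` edges are compared. -/
noncomputable def lengthScale (k : ℕ) : ℕ → ℝ
  | 0 => 1
  -- The length 5c + 17 required by `exists_shortcut` for c = k · `lengthScale k j`; the extra
  -- middle term makes the scales increase for every k.
  | j + 1 => 5 * (k * lengthScale k j) + lengthScale k j + 17

theorem lengthScale_pos (k j : ℕ) : 0 < lengthScale k j := by
  induction j with
  | zero => exact one_pos
  | succ j ih => rw [lengthScale]; positivity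

theorem lengthScale_strictMono (k : ℕ) : StrictMono (lengthScale k) := by
  refine strictMono_nat_of_lt_succ fun j => ?_
  have := lengthScale_pos k j
  rw [lengthScale]
  have : 0 ≤ 5 * (k * lengthScale k j) := by positivity
  linarith

/-- Some scale is skipped by the values of a function on a set of `k` elements. -/
theorem exists_lengthScale_gap {E : Type*} {K : Set E} (hK : K.Finite) {k : ℕ} (hk : K.ncard = k)
    (len : E → ℝ) : ∃ j ≤ k, ∀ e ∈ K, len e < lengthScale k j ∨ lengthScale k (j + 1) ≤ len e := by
  by_contra! hno
  have : Nonempty E := ⟨(hno 0 (Nat.zero_le _)).choose⟩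
  choose! e he h1 h2 using hno
  -- Pigeonhole: the k + 1 half-open ranges between successive scales are disjoint, and k lengths
  -- cannot meet all of them.
  have hmaps : ∀ j ∈ Finset.range (k + 1), e j ∈ hK.toFinset := fun j hj =>
    hK.mem_toFinset.2 (he j (Nat.lt_succ_iff.1 (Finset.mem_range.1 hj)))
  have hcard : hK.toFinset.card < (Finset.range (k + 1)).card := by
    rw [← Set.ncard_eq_toFinset_card K hK, hk, Finset.card_range]; omega
  obtain ⟨i, hi, j, hj, hij, heq⟩ := Finset.exists_ne_map_eq_of_card_lt_of_maps_to hcard hmaps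
  have hi' := Nat.lt_succ_iff.1 (Finset.mem_range.1 hi)
  have hj' := Nat.lt_succ_iff.1 (Finset.mem_range.1 hj)
  have a1 := h1 i hi'
  have a2 := h2 i hi'
  have b1 := h1 j hj'
  have b2 := h2 j hj'
  rw [heq] at a1 a2
  have := (lengthScale_strictMono k).lt_iff_lt.1 (a1.trans_lt b2)
  have := (lengthScale_strictMono k).lt_iff_lt.1 (b1.trans_lt a2)
  omega

/-- From height R - c on, nontrivial elements displace points by more than c; the first bound is
what `exists_shortcut` requires. The linear estimate r ≤ sinh r < cosh r suffices to choose R. -/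
theorem exists_height (ε : ℝ) (hε : 0 < ε) (c : ℝ) :
    ∃ R, 5 * c + 20 ≤ R ∧ 0 < R - c ∧
      ∀ r, R - c ≤ r → Real.sinh (c / 2) < Real.cosh r * Real.sinh (ε / 2) := by
  have hs : 0 < Real.sinh (ε / 2) := Real.sinh_pos_iff.2 (by linarith)
  obtain ⟨T, hT⟩ : ∃ T, T = Real.sinh (c / 2) / Real.sinh (ε / 2) := ⟨_, rfl⟩
  refine ⟨max (5 * c + 20) (c + max T 1), le_max_left _ _, ?_, fun r hr => ?_⟩
  · have := le_max_right (5 * c + 20) (c + max T 1)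
    have := le_max_right T 1
    linarith
  · have h1 := le_max_right (5 * c + 20) (c + max T 1)
    have h2 := le_max_left T 1
    have h3 := le_max_right T 1
    rw [← div_lt_iff₀ hs, ← hT]
    have : r ≤ Real.sinh r := Real.self_le_sinh_iff.2 (by linarith)
    linarith [Real.sinh_lt_cosh r]

theorem HypSpace.IsFoot.dist_le {n : ℕ} {C : Set (HypSpace n)} {x y p q : HypSpace n}
    (hp : IsFoot C x p) (hq : IsFoot C y q) : dist x p ≤ dist x y + dist y q :=
  (hp.2 q hq.1).trans (dist_triangle _ _ _)

namespace GraphLift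

variable {n : ℕ} {Γ : Subgroup (HypSpace n ≃ᵢ HypSpace n)} {V E : Type*} {G : MultiGraph V E}
  {f : GraphMap G (HypQuotient Γ)} (L : GraphLift f)

include L

/-- A graph of rank at least two only admits a reduced map of minimal length if the group is
nontrivial. -/
theorem exists_ne_one [Fintype V] [Fintype E] (hΓ : IsHyperbolicManifoldGroup Γ)
    (hconn : G.Connected) (hred : f.IsReduced) (hmin : f.MinimalRelVertices)
    (hcard : Fintype.card V < Fintype.card E) (hcore : G.coreEdges.Nonempty) :
    ∃ γ ∈ Γ, γ ≠ 1 := by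
  obtain ⟨e, he⟩ := hcore
  obtain ⟨z, Z, hZ, -, -⟩ := exists_isSimpleClosed_avoiding hconn hcard he (d := (e, true)) rfl
  exact ⟨L.hol Z, L.hol_mem Z, L.hol_ne_one hΓ hmin hred hZ⟩

/-- Vertices joined by short edges of the core have lifts that are close together. -/
theorem dist_hol_le_of_nodup [Fintype E] {U : Set E} (hU : U ⊆ G.coreEdges) {l : ℝ} (hl : 0 ≤ l)
    (hUl : ∀ e ∈ U, L.len e ≤ l) {u v : V} (p : G.EdgePath u v) (hp : ∀ e ∈ p.edges, e ∈ U)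
    (hn : p.edges.Nodup) :
    dist (L.pos u) (L.hol p (L.pos v)) ≤ G.coreEdges.ncard * l := by
  classical
  refine (L.dist_hol_le p fun e he => hUl e (hp e he)).trans ?_
  gcongr
  rw [← List.toFinset_card_of_nodup hn, ← Set.ncard_coe_finset]
  refine Set.ncard_le_ncard (fun e he => ?_) (Set.toFinite _)
  exact hU (hp e (by simpa using he))

/-- The vertices of the core lie in a bounded neighbourhood of the hull. -/
theorem height_lt [Fintype V] [Fintype E] (hΓ : IsHyperbolicManifoldGroup Γ) {ε : ℝ}
    (hconn : G.Connected) (hred : f.IsReduced) (hmin : f.MinimalRelVertices)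
    (hcard : Fintype.card V < Fintype.card E) {k : ℕ} (hk : G.coreEdges.ncard = k)
    {C : Set (HypSpace n)} (hC : IsHullCandidate Γ ε C) {R : ℝ}
    (hR : 5 * (k * lengthScale k k) + 20 ≤ R) (hR0 : 0 < R - k * lengthScale k k)
    (hR' : ∀ r, R - k * lengthScale k k ≤ r →
      Real.sinh (k * lengthScale k k / 2) < Real.cosh r * Real.sinh (ε / 2))
    {p : V → HypSpace n} (hp : ∀ v, IsFoot C (L.pos v) (p v)) {d : E × Bool}
    (hd : d.1 ∈ G.coreEdges) : dist (L.pos (G.dsrc d)) (p (G.dsrc d)) < R := by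
  classical
  by_contra! hhigh
  -- a highest vertex of the core
  obtain ⟨d₀, hd₀, hmax⟩ := (Finset.univ.filter fun d : E × Bool => d.1 ∈ G.coreEdges).exists_max_image
    (fun d => dist (L.pos (G.dsrc d)) (p (G.dsrc d))) ⟨d, by simpa using hd⟩
  simp only [Finset.mem_filter, Finset.mem_univ, true_and] at hd₀ hmax
  set v := G.dsrc d₀ with hv
  set R₁ := dist (L.pos v) (p v) with hR₁
  have hRR : R ≤ R₁ := hhigh.trans (hmax d hd)
  obtain ⟨j, hj, hgap⟩ := exists_lengthScale_gap (Set.toFinite G.coreEdges) hk L.len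
  set c := (k : ℝ) * lengthScale k j with hc
  -- The scale j depends on the graph, but R was chosen for the largest scale and so serves all of
  -- them.
  have hcc : c ≤ k * lengthScale k k := by
    have := (lengthScale_strictMono k).monotone hj
    rw [hc]; gcongr
  set U : Set E := {e | e ∈ G.coreEdges ∧ L.len e < lengthScale k j} with hU
  have hUc : U ⊆ G.coreEdges := fun e he => he.1
  have hlong : ∀ e ∈ G.coreEdges, e ∉ U → 5 * c + 17 ≤ L.len e := by
    intro e he heU
    have h1 := (hgap e he).resolve_left fun h => heU ⟨he, h⟩
    rw [lengthScale] at h1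
    have := lengthScale_pos k j
    linarith
  have hclose : ∀ {a b : V} (q : G.EdgePath a b), (∀ e ∈ q.edges, e ∈ U) → q.edges.Nodup →
      dist (L.pos a) (L.hol q (L.pos b)) ≤ c := by
    intro a b q hq hn
    have := L.dist_hol_le_of_nodup hUc (lengthScale_pos k j).le (fun e he => he.2.le) q hq hn
    rwa [hk] at this
  have hpath : ∀ {a b : V}, G.JoinedIn U a b → ∃ q : G.EdgePath a b,
      (∀ e ∈ q.edges, e ∈ U) ∧ q.edges.Nodup := by
    rintro a b ⟨q, hq⟩
    obtain ⟨q', h1, h2, h3⟩ := q.exists_simple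
    exact ⟨q', fun e he => hq e (h3 he), q'.nodup_edges h1 h2⟩
  -- Height is Γ-invariant and 1-Lipschitz.
  have hheight : ∀ a, G.JoinedIn U v a → R₁ - c ≤ dist (L.pos a) (p a) := by
    intro a ha
    obtain ⟨q, h1, h2⟩ := hpath ha
    have h3 := hclose q h1 h2
    have h4 := (hp v).dist_le (hC.isFoot_map (L.hol_mem q) (hp a))
    rw [(L.hol q).isometry.dist_eq] at h4
    linarith
  obtain ⟨d₁, d₂, hne, ⟨hc₁, hU₁, hS₁⟩, hc₂, hU₂, hS₂⟩ := exists_two_darts hconn hcard hUc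
    ⟨d₀, hd₀, hv.symm⟩ (by
      intro a ha q hq hqU
      have h1 := hclose q hqU hq.2.1
      have h2 := hheight a ha
      have h3 := hC.cosh_mul_sinh_le (L.hol_mem q) (L.hol_ne_one hΓ hmin hred hq) (hp a)
        (by linarith)
      have h4 := hR' (dist (L.pos a) (p a)) (by linarith)
      have h5 : Real.sinh (dist (L.pos a) (L.hol q (L.pos a)) / 2) ≤
          Real.sinh (k * lengthScale k k / 2) := Real.sinh_le_sinh.2 (by linarith)
      linarith)
  -- drag the end of the first edge over to the second
  have hj : G.JoinedIn U (G.dtgt (flip d₁)) (G.dsrc d₂) := by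
    rw [dtgt_flip]; exact hS₁.symm.trans hS₂
  obtain ⟨α, hα, hαn⟩ := hpath hj
  have hS₁' : G.JoinedIn U v (G.dtgt (flip d₁)) := by rwa [dtgt_flip]
  have hc₁' : (flip d₁).1 ∈ G.coreEdges := hc₁
  have hU₁' : (flip d₁).1 ∉ U := hU₁
  have hne' : d₂.1 ≠ (flip d₁).1 := hne.symm
  generalize flip d₁ = b at *
  set g := L.dlab b * L.hol α with hg
  have hgm : g ∈ Γ := Γ.mul_mem (L.dlab_mem b) (L.hol_mem α)
  have e₁ : dist (L.dlab b (L.pos (G.dtgt b))) (L.pos (G.dsrc b)) = L.len b.1 := by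
    rw [dist_comm]; exact L.dist_dart b
  have e₂ : dist (g (L.pos (G.dsrc d₂))) (g (L.dlab d₂ (L.pos (G.dtgt d₂)))) = L.len d₂.1 := by
    rw [g.isometry.dist_eq]; exact L.dist_dart d₂
  have hend : dist (L.pos (G.dtgt d₂)) (p (G.dtgt d₂)) ≤ R₁ := by
    have := hmax (flip d₂) hc₂
    rwa [dsrc_flip] at this
  -- The two geodesics are the lift of b, read from its end in S, and the translate by g of the lift
  -- of `d₂`. The path α of short edges keeps their starting points within c, and invariance of C
  -- keeps the heights.
  obtain ⟨z, hz, hlt⟩ := exists_shortcut hC.convex (c := c) (R := R₁)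
    (hC.isFoot_map (L.dlab_mem b) (hp (G.dtgt b)))
    (hC.isFoot_map hgm (hp (G.dsrc d₂))) (hp (G.dsrc b))
    (hC.isFoot_map hgm (hC.isFoot_map (L.dlab_mem d₂) (hp (G.dtgt d₂))))
    (by
      have : g (L.pos (G.dsrc d₂)) = L.dlab b (L.hol α (L.pos (G.dsrc d₂))) := rfl
      rw [this, (L.dlab b).isometry.dist_eq]
      exact hclose α hα hαn)
    (by linarith)
    (by rw [(L.dlab b).isometry.dist_eq]; exact hheight _ hS₁')
    (by rw [g.isometry.dist_eq]; exact hheight _ hS₂)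
    (hmax b hc₁')
    (by rw [g.isometry.dist_eq, (L.dlab d₂).isometry.dist_eq]; exact hend)
    (by rw [e₁]; exact hlong _ hc₁' hU₁')
    (by rw [e₂]; exact hlong _ hc₂ hU₂)
  have hgz : g (g⁻¹ z) = z := g.apply_symm_apply z
  have key := L.len_le_of_dart hΓ hmin b d₂ hne' α (fun h => hU₁' (hα _ h)) (z := g⁻¹ z) (by
    rw [← g.isometry.dist_eq _ (g⁻¹ z), ← g.isometry.dist_eq (g⁻¹ z), hgz, hz, e₂])
  have hgz' : L.dlab b (L.hol α (g⁻¹ z)) = z := hgz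
  rw [hgz', dist_comm] at key
  rw [e₁] at hlt
  linarith

end GraphLift

/-- A connected finite graph has rank |E| - |V| + 1, so the inequality between the cardinalities
says that the rank is at least two. -/
theorem mainTheorem7 (n : ℕ) (ε : ℝ) (hε : 0 < ε) (k : ℕ) :
    ∃ D : ℝ, 0 < D ∧
      ∀ (Γ : Subgroup (HypSpace n ≃ᵢ HypSpace n)), IsHyperbolicManifoldGroup Γ →
      ∀ (V E : Type*) [Fintype V] [Fintype E] (X : MultiGraph V E)
        (f : GraphMap X (HypQuotient Γ)),
        f.IsCarrierGraph → f.IsReduced → f.MinimalRelVertices →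
        Fintype.card V < Fintype.card E →
        X.coreEdges.ncard = k →
        f.coreImage ⊆ Metric.thickening D (thickCore Γ ε) := by
  obtain ⟨R, hR, hR0, hR'⟩ := exists_height ε hε (k * lengthScale k k)
  have hc : 0 ≤ k * lengthScale k k := by
    have := lengthScale_pos k k
    positivity
  -- Core vertices have height below R, and interior points of edges at most R + 9/4.
  refine ⟨R + 3, by linarith, ?_⟩
  intro Γ hΓ V E _ _ X f hcar hred hmin hcard hk x hx
  simp only [GraphMap.coreImage, mem_iUnion, mem_range] at hx
  obtain ⟨e, he, t, rfl⟩ := hx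
  obtain ⟨L⟩ := GraphLift.nonempty hΓ f
  obtain ⟨γ, hγ, hγ1⟩ := L.exists_ne_one hΓ hcar.connected hred hmin hcard ⟨e, he⟩
  have hC := isHullCandidate_thickHull hΓ hε hγ hγ1
  choose p hp using fun v => exists_isFoot hC.nonempty hC.closed (L.pos v)
  have hlow : ∀ d : E × Bool, d.1 = e → dist (L.pos (X.dsrc d)) (p (X.dsrc d)) < R :=
    fun d hd => L.height_lt hΓ hcar.connected hred hmin hcard hk hC hR hR0 hR' hp (hd ▸ he)
  obtain ⟨z, hz, hbetween⟩ := (L.lifts e).exists_between hΓ (L.eVariationOn_edge_le hΓ hmin e) t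
  obtain ⟨w, hw⟩ := exists_isFoot hC.nonempty hC.closed z
  have hdist := dist_foot_between hC.convex (D := R) (hp (X.src e)).1
    (hC.invariant _ (L.lab_mem e) _ (hp (X.tgt e)).1) (hlow (e, true) rfl).le
    (by rw [(L.lab e).isometry.dist_eq]; exact (hlow (e, false) rfl).le) hbetween hw
  refine Metric.mem_thickening_iff.2 ⟨proj Γ w, mem_image_of_mem _ hw.1, ?_⟩
  rw [← hz]
  exact (dist_proj_le z w).trans_lt (by linarith)
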